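/- Let $X$ be one of the following open curves: the real line $\mathbb{R}$; an open interval $(\gamma,\delta)$ with $\gamma<\delta$ real; or an open arc $\{e^{i\theta}: a<\theta<b\}$ of the unit circle with $a<b\le a+2\pi$. Derivatives $u^{(l)}$ of functions $u:X\to\mathbb{C}$ are taken with respect to the real variable in the first two cases and with respect to $\theta$ in the third. For $k\in\{0,1,2,\dots\}\cup\{\infty\}$ let - $C^k(X)$ be the space of $k$ times continuously differentiable functions $u:X\to\mathbb{C}$, with the topology of uniform convergence on compact subsets of $X$ of the derivatives $u^{(l)}$ of all finite orders $l\le k$; - $C^k_b(X)$ be the space of those $u\in C^k(X)$ for which $u^{(l)}$ is bounded for all finite $l\le k$, with the topology defined by the seminorms $\sup_X|u^{(l)}|$, $l\le k$; - $C^k_0(X)$ be the subspace of $C^k_b(X)$ of those $u$ for which $u^{(l)}$ tends to $0$ at both ends of $X$ for all finite $l\le k$. If $X$ is $\mathbb{R}$ or an interval, put $S_+=\{\operatorname{Im}z>0\}$ and $S_-=\{\operatorname{Im}z<0\}$; if $X$ is an arc, put $S_+=\{|z|>1\}$ and $S_-=\{|z|<1\}$. Write $D(z_0,r)$ for the open disc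 with centre $z_0$ and radius $r$. For a side $S\in\{S_+,S_-\}$ say that $u:X\to\mathbb{C}$ extends from the side $S$ at $z_0\in X$ if there are $r>0$ and a continuous function $\lambda:X\cup(D(z_0,r)\cap S)\to\mathbb{C}$ that is holomorphic on $D(z_0,r)\cap S$ and satisfies $\lambda=u$ on $D(z_0,r)\cap X$. In each of the spaces $C^k(X)$, $C_b^k(X)$, $C_0^k(X)$ consider the classes - $U_2(X,k)$: the functions that extend from the side $S_+$ at no point of $X$; - $U_3(X,k)$: the functions that extend from the side $S_-$ at no point of $X$; - $U_4(X,k)$: the functions that extend neither from the side $S_+$ nor from the side $S_-$ at any point of $X$; - $U_5(X,k)$: the functions $u$ for which there are no $z_0\in X$, $r>0$ and holomorphic $f:D(z_0,r)\to\mathbb{C}$ with $f=u$ on $D(z_0,r)\cap X$. Theorem. For every such $X$ and every $k\in\{0,1,2,\dots\}\cup\{\infty\}$, each of the classes $U_2(X,k)$, $U_3(X,k)$, $U_4(X,k)$, $U_5(X,k)$ is a dense $G_\delta$ subset of $C^k(X)$, and the corresponding classes in $C_b^k(X)$ and in $C_0^k(X)$ are dense $G_\delta$ subsets of $C_b^k(X)$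 and of $C_0^k(X)$, respectively. -/

import Mathlib

open Set Filter Topology

namespace OneSidedExtension

/-! ### Function spaces on an open curve

`X` is the curve, viewed as a topological space: the real line, an open interval, or an open arc of
the unit circle.  The map `t : X → ℝ` is its real coordinate, a homeomorphism onto an open subset
of `ℝ`: the identity of `ℝ`, the inclusion of an interval, or the angle on an arc.
Differentiability and derivatives of `u : X → ℂ` are those with respect to this coordinate. -/

section Spaces

variable {X : Type}

/-- The function `u : X → ℂ` written in the coordinate `t`, that is `u ∘ t⁻¹` on the range of `t`
(and `0` outside). -/
noncomputable def inCoord (t : X → ℝ) (u : X → ℂ) : ℝ → ℂ := Function.extend t u 0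

/-- The `l`-th derivative of `u` with respect to the coordinate `t`, as a function on `X`. -/
noncomputable def curveDeriv (t : X → ℝ) (l : ℕ) (u : X → ℂ) : X → ℂ :=
  fun x => iteratedDeriv l (inCoord t u) (t x)

/-- The space `C^k(X)`, `k = 0, 1, 2, …, ∞`. -/
structure Ck (t : X → ℝ) (k : ℕ∞) where
  /-- the underlying function -/
  toFun : X → ℂ
  contDiff : ContDiffOn ℝ (k : WithTop ℕ∞) (inCoord t toFun) (range t)

/-- The space `C_b^k(X)` of the functions in `C^k(X)` all of whose derivatives of order `l ≤ k`
are bounded. -/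
structure Ckb (t : X → ℝ) (k : ℕ∞) extends Ck t k where
  bounded : ∀ l : ℕ, (l : ℕ∞) ≤ k → ∃ C : ℝ, ∀ x : X, ‖curveDeriv t l toFun x‖ ≤ C

/-- The space `C_0^k(X)` of the functions in `C_b^k(X)` all of whose derivatives of order `l ≤ k`
tend to zero at both ends of `X`. -/
structure Ck0 (t : X → ℝ) (k : ℕ∞) [TopologicalSpace X] extends Ckb t k where
  vanishing : ∀ l : ℕ, (l : ℕ∞) ≤ k → Tendsto (curveDeriv t l toFun) (cocompact X) (𝓝 0)

variable [TopologicalSpace X]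

/-- The topology of `C^k(X)`: uniform convergence on the compact subsets of `X` of all derivatives
of order `l ≤ k`. -/
noncomputable instance Ck.instTopologicalSpace (t : X → ℝ) (k : ℕ∞) :
    TopologicalSpace (Ck t k) :=
  ⨅ (l : ℕ) (_ : (l : ℕ∞) ≤ k), TopologicalSpace.induced
    (fun u : Ck t k => UniformOnFun.ofFun {K : Set X | IsCompact K} (curveDeriv t l u.toFun))
    inferInstance

/-- The topology of `C_b^k(X)`: uniform convergence on the whole of `X` of all derivatives of
order `l ≤ k`, i.e. the topology of the seminorms `sup_X |u^(l)|`. -/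
noncomputable instance Ckb.instTopologicalSpace (t : X → ℝ) (k : ℕ∞) :
    TopologicalSpace (Ckb t k) :=
  ⨅ (l : ℕ) (_ : (l : ℕ∞) ≤ k), TopologicalSpace.induced
    (fun u : Ckb t k => UniformFun.ofFun (curveDeriv t l u.toFun)) inferInstance

/-- `C_0^k(X)` is topologized as a subspace of `C_b^k(X)`. -/
noncomputable instance Ck0.instTopologicalSpace (t : X → ℝ) (k : ℕ∞) :
    TopologicalSpace (Ck0 t k) :=
  TopologicalSpace.induced Ck0.toCkb inferInstance

end Spaces

/-! ### Classes of non-extendable functions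

`ι : X → ℂ` is the inclusion of the curve in the plane, and `S`, `S'` are its two sides. -/

section Classes

variable {X : Type}

/-- `u` extends from the side `S` near the point `z₀`: for some `r > 0` there is a function `F`,
continuous on the union of the curve and `D(z₀, r) ∩ S`, holomorphic on `D(z₀, r) ∩ S`, and equal
to `u` on the part of the curve inside `D(z₀, r)`. -/
def ExtendsFromSideAt (ι : X → ℂ) (S : Set ℂ) (u : X → ℂ) (z₀ : ℂ) : Prop :=
  ∃ r : ℝ, 0 < r ∧ ∃ F : ℂ → ℂ,
    ContinuousOn F (range ι ∪ (Metric.ball z₀ r ∩ S)) ∧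
    DifferentiableOn ℂ F (Metric.ball z₀ r ∩ S) ∧
    ∀ x : X, ι x ∈ Metric.ball z₀ r → F (ι x) = u x

/-- `u` extends to a disc centred at `z₀`: for some `r > 0` there is a holomorphic function on
`D(z₀, r)` equal to `u` on the part of the curve inside `D(z₀, r)`. -/
def ExtendsToDiscAt (ι : X → ℂ) (u : X → ℂ) (z₀ : ℂ) : Prop :=
  ∃ r : ℝ, 0 < r ∧ ∃ F : ℂ → ℂ,
    DifferentiableOn ℂ F (Metric.ball z₀ r) ∧
    ∀ x : X, ι x ∈ Metric.ball z₀ r → F (ι x) = u x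

/-- Functions that do not extend from the side `S` at any point of the curve: the class `U₂` when
`S` is the upper half-plane (or the exterior of the unit disc), the class `U₃` when `S` is the
lower half-plane (or the unit disc). -/
def NonextSide (ι : X → ℂ) (S : Set ℂ) : Set (X → ℂ) :=
  {u | ¬ ∃ x₀ : X, ExtendsFromSideAt ι S u (ι x₀)}

/-- The class `U₄` of functions that extend neither from the side `S` nor from the side `S'`, at any
point of the curve. -/
def NonextBothSides (ι : X → ℂ) (S S' : Set ℂ) : Set (X → ℂ) :=
  {u | (¬ ∃ x₀ : X, ExtendsFromSideAt ι S u (ι x₀)) ∧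
       (¬ ∃ x₀ : X, ExtendsFromSideAt ι S' u (ι x₀))}

/-- The class `U₅` of functions that do not extend to any disc centred at a point of the curve. -/
def NonextDisc (ι : X → ℂ) : Set (X → ℂ) :=
  {u | ¬ ∃ x₀ : X, ExtendsToDiscAt ι u (ι x₀)}

/-- The members of the class `U` lying in the function space form a dense `G_δ` subset of it, for
each of the three spaces `C^k(X)`, `C_b^k(X)`, `C_0^k(X)`. -/
def DenseGdeltaInSpaces [TopologicalSpace X] (t : X → ℝ) (k : ℕ∞) (U : Set (X → ℂ)) : Prop :=
  (Dense {u : Ck t k | u.toFun ∈ U} ∧ IsGδ {u : Ck t k | u.toFun ∈ U}) ∧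
  (Dense {u : Ckb t k | u.toFun ∈ U} ∧ IsGδ {u : Ckb t k | u.toFun ∈ U}) ∧
  (Dense {u : Ck0 t k | u.toFun ∈ U} ∧ IsGδ {u : Ck0 t k | u.toFun ∈ U})

end Classes

/-! ### The line, open intervals and open arcs -/

/-- The open upper half-plane. -/
def upperSide : Set ℂ := {z | 0 < z.im}

/-- The open lower half-plane. -/
def lowerSide : Set ℂ := {z | z.im < 0}

/-- The exterior of the closed unit disc. -/
def outerSide : Set ℂ := {z | 1 < ‖z‖}

/-- The open unit disc. -/
def innerSide : Set ℂ := {z | ‖z‖ < 1}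

/-- The inclusion of the real line in the plane. -/
def lineIncl : ℝ → ℂ := fun x => (x : ℂ)

/-- The inclusion of the interval `(γ, δ)` in the plane. -/
def intervalIncl (γ δ : ℝ) : Ioo γ δ → ℂ := fun x => ((x : ℝ) : ℂ)

/-- The point `e^{iθ}`. -/
noncomputable def circlePoint (θ : ℝ) : ℂ := Complex.exp (θ * Complex.I)

/-- The open arc `{e^{iθ} : a < θ < b}` of the unit circle. -/
def openArc (a b : ℝ) : Set ℂ := circlePoint '' Ioo a b

/-- The angle `θ ∈ (a, b)` of a point `e^{iθ}` of the open arc; it is unique if `b ≤ a + 2π`. -/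
noncomputable def arcAngle (a b : ℝ) : openArc a b → ℝ :=
  fun z => Function.invFunOn circlePoint (Ioo a b) (z : ℂ)

theorem arcAngle_mem (a b : ℝ) (z : openArc a b) : arcAngle a b z ∈ Ioo a b :=
  Function.invFunOn_mem z.2

theorem circlePoint_arcAngle (a b : ℝ) (z : openArc a b) :
    circlePoint (arcAngle a b z) = z :=
  Function.invFunOn_eq z.2

/-- The inclusion of the open arc in the plane. -/
def arcIncl (a b : ℝ) : openArc a b → ℂ := Subtype.val

end OneSidedExtension

open OneSidedExtension

/-! A chart `e`, either the identity or z ↦ exp(iz), is entire without critical points and carries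
the real axis to the line or circle containing the curve and half-planes to its sides. Every
extension question thus becomes one about `FlatExt O`, where `O` is a half-plane or, for holomorphy
on a full disc, the whole plane. The four classes correspond to the families {upper}, {lower},
{upper, lower} and {plane}, with the half-planes interchanged for arcs.

G_δ: a function that extends somewhere has an extension bounded by a natural number on one of
countably many rational discs. If functions with extensions bounded by `M` on a disc converge
uniformly on its real diameter, a two-constants estimate makes the extensions converge uniformly on
the concentric disc of one ninth the radius, so the limit still extends there (`flatExt_of_approx`).
The extendable functions are therefore a countable union of closed sets. Only the functions
themselves enter, not their derivatives, so this works for every `k`, and it passes to the bounded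
and vanishing spaces by continuity of the inclusions.

Density: it suffices to have one smooth `W`, with bounded derivatives tending to zero at the ends,
that extends nowhere. For fixed `u`, each region and rational disc excludes at most one real ε for
which u + εW extends, because the difference of two such functions is a nonzero multiple of `W`.
Hence u + εW is good for all but countably many ε, and it tends to `u` as ε → 0. Baire's theorem is
not needed in the function spaces; it is used once, in ℓ^∞, to choose the coefficients of a series
of bumps defining `W` (`exists_nowhere_flatExt`). -/

namespace OneSidedExtension

open scoped ContDiff

/-! ### One-sided extensions in the flat model -/

/-- The regions of the plane on which extensions in the coordinate are considered. -/
def flatRegions : Set (Set ℂ) := {upperSide, lowerSide, univ}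

/-- The set `O` together with the real line. -/
def withLine (O : Set ℂ) : Set ℂ := O ∪ {z | z.im = 0}

/-- `f` extends continuously from the real axis to the part of the disc `D(x, r)` in `O`,
holomorphically on this part. -/
def FlatExt (O : Set ℂ) (f : ℝ → ℂ) (x r : ℝ) : Prop :=
  ∃ G : ℂ → ℂ, ContinuousOn G (Metric.ball (x : ℂ) r ∩ withLine O) ∧
    DifferentiableOn ℂ G (Metric.ball (x : ℂ) r ∩ O) ∧
    ∀ y : ℝ, (y : ℂ) ∈ Metric.ball (x : ℂ) r → G y = f y

/-- `f` extends as in `FlatExt`, up to the boundary of the disc and with values bounded by `M`. -/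
def BddFlatExt (O : Set ℂ) (f : ℝ → ℂ) (x r M : ℝ) : Prop :=
  ∃ G : ℂ → ℂ, ContinuousOn G (Metric.closedBall (x : ℂ) r ∩ withLine O) ∧
    DifferentiableOn ℂ G (Metric.ball (x : ℂ) r ∩ O) ∧
    (∀ z ∈ Metric.closedBall (x : ℂ) r ∩ withLine O, ‖G z‖ ≤ M) ∧
    ∀ y : ℝ, (y : ℂ) ∈ Metric.closedBall (x : ℂ) r → G y = f y

theorem countable_flatRegions : flatRegions.Countable :=
  ((countable_singleton (univ : Set ℂ)).insert lowerSide).insert upperSide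

theorem isOpen_of_mem_flatRegions {O : Set ℂ} (hO : O ∈ flatRegions) : IsOpen O := by
  rcases hO with rfl | rfl | rfl
  · exact isOpen_lt continuous_const Complex.continuous_im
  · exact isOpen_lt Complex.continuous_im continuous_const
  · exact isOpen_univ

theorem isClosed_withLine {O : Set ℂ} (hO : O ∈ flatRegions) : IsClosed (withLine O) := by
  rcases hO with rfl | rfl | rfl
  · have : withLine upperSide = {z : ℂ | 0 ≤ z.im} := by
      ext z; simp [withLine, upperSide, le_iff_lt_or_eq, eq_comm]
    rw [this]; exact isClosed_le continuous_const Complex.continuous_im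
  · have : withLine lowerSide = {z : ℂ | z.im ≤ 0} := by
      ext z; simp [withLine, lowerSide, le_iff_lt_or_eq]
    rw [this]; exact isClosed_le Complex.continuous_im continuous_const
  · simp [withLine]

theorem convex_of_mem_flatRegions {O : Set ℂ} (hO : O ∈ flatRegions) : Convex ℝ O := by
  rcases hO with rfl | rfl | rfl
  · exact convex_halfSpace_im_gt 0
  · exact convex_halfSpace_im_lt 0
  · exact convex_univ

theorem ofReal_mem_closedBall {x y r : ℝ} :
    (y : ℂ) ∈ Metric.closedBall (x : ℂ) r ↔ |y - x| ≤ r := by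
  rw [mem_closedBall_iff_norm, ← Complex.ofReal_sub, Complex.norm_real, Real.norm_eq_abs]

theorem ofReal_mem_ball {x y r : ℝ} :
    (y : ℂ) ∈ Metric.ball (x : ℂ) r ↔ |y - x| < r := by
  rw [mem_ball_iff_norm, ← Complex.ofReal_sub, Complex.norm_real, Real.norm_eq_abs]

/-! ### A two-constants estimate -/

/-- The maximum principle is applied to `G` times an explicit exponential, which replaces the
harmonic measure of the diameter. -/
theorem two_constants_halfDisc {G : ℂ → ℂ} {M δ : ℝ} (hδ : 0 < δ) (hδM : δ ≤ M)
    (hc : ContinuousOn G (Metric.closedBall 0 1 ∩ {z | 0 ≤ z.im}))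
    (hd : DifferentiableOn ℂ G (Metric.ball 0 1 ∩ {z | 0 < z.im}))
    (hM : ∀ z ∈ Metric.closedBall (0 : ℂ) 1 ∩ {z | 0 ≤ z.im}, ‖G z‖ ≤ M)
    (hδG : ∀ z ∈ Metric.closedBall (0 : ℂ) 1, z.im = 0 → ‖G z‖ ≤ δ)
    {z : ℂ} (hz : ‖z‖ ≤ 1 / 9) (hz' : 0 ≤ z.im) : ‖G z‖ ^ 2 ≤ M * δ := by
  have hMpos : 0 < M := hδ.trans_le hδM
  rcases hz'.eq_or_lt with h0 | hpos
  · have := hδG z (by simp; linarith) h0.symm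
    nlinarith [norm_nonneg (G z)]
  set N : ℝ := Real.log (M / δ) with hN
  have hN0 : 0 ≤ N := Real.log_nonneg ((one_le_div hδ).2 hδM)
  have hexpN : Real.exp N = M / δ := Real.exp_log (div_pos hMpos hδ)
  -- The real part of `h` is at most 0 on the diameter and at most -N on the unit semicircle, where
  -- it equals N(2y² - 1 - 4y) with 0 ≤ y ≤ 1. So exp(h)·G is bounded by `δ` on the whole boundary.
  set h : ℂ → ℂ := fun w => N * (-w ^ 2 + 4 * Complex.I * w) with hh
  have hre : ∀ w : ℂ, (h w).re = N * (w.im ^ 2 - w.re ^ 2 - 4 * w.im) := by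
    intro w
    simp only [hh, Complex.ofReal_re, Complex.ofReal_im, Complex.add_re, Complex.neg_re, sq, Complex.mul_re,
      Complex.mul_im, Complex.I_re, Complex.I_im, Complex.re_ofNat, Complex.im_ofNat]
    ring
  set U : Set ℂ := Metric.ball 0 1 ∩ {z | 0 < z.im} with hU
  have hUo : IsOpen U :=
    Metric.isOpen_ball.inter (isOpen_lt continuous_const Complex.continuous_im)
  have hcl : closure U ⊆ Metric.closedBall 0 1 ∩ {z | 0 ≤ z.im} := by
    apply closure_minimal
    · exact inter_subset_inter Metric.ball_subset_closedBall fun w (hw : 0 < w.im) => hw.le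
    · exact Metric.isClosed_closedBall.inter
        (isClosed_le continuous_const Complex.continuous_im)
  have hhd : Differentiable ℂ h := by fun_prop
  have hnorm : ∀ w, ‖Complex.exp (h w) * G w‖
      = Real.exp (N * (w.im ^ 2 - w.re ^ 2 - 4 * w.im)) * ‖G w‖ := by
    intro w; rw [norm_mul, Complex.norm_exp, hre]
  have key : ‖Complex.exp (h z) * G z‖ ≤ δ := by
    refine Complex.norm_le_of_forall_mem_frontier_norm_le (U := U)
      (f := fun w => Complex.exp (h w) * G w) (Metric.isBounded_ball.subset inter_subset_left)
      ⟨hhd.cexp.differentiableOn.mul hd, hhd.continuous.cexp.continuousOn.mul (hc.mono hcl)⟩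
      ?_ (subset_closure ⟨by simp; linarith, hpos⟩)
    intro w hw
    have hwcl := hcl (frontier_subset_closure hw)
    have hwU : w ∉ U := by
      rw [hUo.frontier_eq] at hw; exact hw.2
    have hw1 : ‖w‖ ≤ 1 := by simpa using hwcl.1
    have hwim : 0 ≤ w.im := hwcl.2
    rw [hnorm]
    by_cases h0 : w.im = 0
    · have h1 : Real.exp (N * (w.im ^ 2 - w.re ^ 2 - 4 * w.im)) ≤ 1 := by
        rw [Real.exp_le_one_iff, h0]; nlinarith [mul_nonneg hN0 (sq_nonneg w.re)]
      have := hδG w hwcl.1 h0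
      calc _ ≤ 1 * δ := by gcongr
        _ = δ := one_mul δ
    · have hwn : ‖w‖ = 1 := by
        refine le_antisymm hw1 (not_lt.1 fun hlt => hwU ⟨by simpa using hlt, ?_⟩)
        exact lt_of_le_of_ne hwim (Ne.symm h0)
      have hsq : w.re ^ 2 + w.im ^ 2 = 1 := by
        have := Complex.sq_norm w
        rw [hwn, Complex.normSq_apply] at this; linarith
      have him1 : w.im ≤ 1 := by nlinarith [sq_nonneg w.re]
      have h1 : Real.exp (N * (w.im ^ 2 - w.re ^ 2 - 4 * w.im)) ≤ Real.exp (-N) := by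
        apply Real.exp_le_exp.2
        have : w.im ^ 2 - w.re ^ 2 - 4 * w.im ≤ -1 := by nlinarith
        nlinarith
      calc _ ≤ Real.exp (-N) * M := by gcongr; exact hM w hwcl
        _ = δ := by rw [Real.exp_neg, hexpN]; field_simp
  rw [hnorm] at key
  have h1 : Real.exp (-(N / 2)) ≤ Real.exp (N * (z.im ^ 2 - z.re ^ 2 - 4 * z.im)) := by
    apply Real.exp_le_exp.2
    have hi := (Complex.abs_im_le_norm z).trans hz
    have hr := (Complex.abs_re_le_norm z).trans hz
    rw [abs_le] at hi hr
    -- The radius 1/9 comes from here: 1/81 + 4/9 < 1/2, and the exponent -N/2 gives the geometric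
    -- mean of `M` and `δ`.
    have : -(1 / 2) ≤ z.im ^ 2 - z.re ^ 2 - 4 * z.im := by nlinarith
    nlinarith
  have h2 : Real.exp (-(N / 2)) * ‖G z‖ ≤ δ :=
    (mul_le_mul_of_nonneg_right h1 (norm_nonneg _)).trans key
  have h3 : Real.exp (-(N / 2)) ^ 2 = δ / M := by
    rw [← Real.exp_nat_mul]
    have : ((2 : ℕ) : ℝ) * -(N / 2) = -N := by push_cast; ring
    rw [this, Real.exp_neg, hexpN, inv_div]
  have h4 : (Real.exp (-(N / 2)) * ‖G z‖) ^ 2 ≤ δ ^ 2 := by gcongr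
  rw [mul_pow, h3, div_mul_eq_mul_div, div_le_iff₀ hMpos] at h4
  have : δ * ‖G z‖ ^ 2 ≤ δ * (M * δ) := by nlinarith
  exact le_of_mul_le_mul_left this hδ

/-- The map w ↦ x + cw with c = r or c = -r transports the estimate to an upper or a lower
half-disc. When `O` is the plane, the sign of Im z decides which half is used. -/
theorem two_constants {O : Set ℂ} (hO : O ∈ flatRegions) {G : ℂ → ℂ} {x r M δ : ℝ} (hr : 0 < r)
    (hδ : 0 < δ) (hδM : δ ≤ M)
    (hc : ContinuousOn G (Metric.closedBall (x : ℂ) r ∩ withLine O))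
    (hd : DifferentiableOn ℂ G (Metric.ball (x : ℂ) r ∩ O))
    (hM : ∀ z ∈ Metric.closedBall (x : ℂ) r ∩ withLine O, ‖G z‖ ≤ M)
    (hδG : ∀ y : ℝ, (y : ℂ) ∈ Metric.closedBall (x : ℂ) r → ‖G y‖ ≤ δ)
    {z : ℂ} (hz : z ∈ Metric.ball (x : ℂ) (r / 9) ∩ withLine O) : ‖G z‖ ^ 2 ≤ M * δ := by
  have half : ∀ c : ℝ, |c| = r → (∀ w : ℂ, 0 < w.im → (x + c * w : ℂ) ∈ O) →
      0 ≤ ((z - x) / c).im → ‖G z‖ ^ 2 ≤ M * δ := by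
    intro c hcr hcO hzim
    have hc0 : (c : ℂ) ≠ 0 := by
      rintro h; rw [Complex.ofReal_eq_zero] at h; simp [h] at hcr; linarith
    have hn : ∀ w : ℂ, ‖(x + c * w : ℂ) - x‖ = r * ‖w‖ := by
      intro w; rw [add_sub_cancel_left, norm_mul, Complex.norm_real, Real.norm_eq_abs, hcr]
    have hline : ∀ w : ℂ, 0 ≤ w.im → (x + c * w : ℂ) ∈ withLine O := by
      intro w hw
      rcases hw.eq_or_lt with h | h
      · right; simp [← h]
      · exact Or.inl (hcO w h)
    have hcb : ∀ w ∈ Metric.closedBall (0 : ℂ) 1,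
        (x + c * w : ℂ) ∈ Metric.closedBall (x : ℂ) r := by
      intro w hw
      rw [mem_closedBall_iff_norm, hn]
      rw [mem_closedBall_zero_iff] at hw
      nlinarith
    have hmaps : MapsTo (fun w : ℂ => (x + c * w : ℂ))
        (Metric.closedBall 0 1 ∩ {z | 0 ≤ z.im}) (Metric.closedBall (x : ℂ) r ∩ withLine O) :=
      fun w hw => ⟨hcb w hw.1, hline w hw.2⟩
    have key := two_constants_halfDisc (G := fun w => G (x + c * w)) hδ hδM
      (hc.comp (by fun_prop) hmaps)
      (hd.comp (t := Metric.ball (x : ℂ) r ∩ O) (by fun_prop) (fun w hw => ⟨by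
        have := hw.1
        rw [mem_ball_zero_iff] at this
        rw [mem_ball_iff_norm, hn]; nlinarith, hcO w hw.2⟩))
      (fun w hw => hM _ (hmaps hw))
      (fun w hw hw0 => by
        have hre : (x + c * w : ℂ) = ((x + c * w.re : ℝ) : ℂ) := by
          apply Complex.ext <;> simp [hw0]
        have := hcb w hw
        simp only [hre] at this ⊢
        exact hδG _ this)
      (z := (z - x) / c) (by
        have := hz.1
        rw [mem_ball_iff_norm] at this
        rw [norm_div, Complex.norm_real, Real.norm_eq_abs, hcr, div_le_iff₀ hr]; linarith)
      hzim
    have e : (x + c * ((z - x) / c) : ℂ) = z := by field_simp; ring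
    simpa only [e] using key
  have him : ∀ c : ℝ, ((z - x) / c : ℂ).im = z.im / c := by
    intro c; rw [Complex.div_ofReal_im]; simp
  have hup : (∀ w : ℂ, 0 < w.im → (x + r * w : ℂ) ∈ O) → 0 ≤ z.im → ‖G z‖ ^ 2 ≤ M * δ :=
    fun h1 h2 => half r (abs_of_pos hr) h1 (by rw [him]; positivity)
  have hlow : (∀ w : ℂ, 0 < w.im → (x + (-r : ℝ) * w : ℂ) ∈ O) → z.im ≤ 0 →
      ‖G z‖ ^ 2 ≤ M * δ :=
    fun h1 h2 => half (-r) (by rw [abs_neg, abs_of_pos hr]) h1 (by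
      rw [him, div_neg, ← neg_div]; exact div_nonneg (by linarith) hr.le)
  rcases hO with rfl | rfl | rfl
  · refine hup (fun w hw => by simp [upperSide]; positivity) ?_
    rcases hz.2 with h | h
    · exact le_of_lt h
    · exact ge_of_eq h
  · refine hlow (fun w hw => by simp [lowerSide]; positivity) ?_
    rcases hz.2 with h | h
    · exact le_of_lt h
    · exact le_of_eq h
  · rcases le_total 0 z.im with h | h
    · exact hup (fun w hw => mem_univ _) h
    · exact hlow (fun w hw => mem_univ _) h

/-! ### Elementary properties of extensions -/

theorem FlatExt.congr {O : Set ℂ} {f g : ℝ → ℂ} {x r : ℝ} (h : FlatExt O f x r)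
    (hfg : ∀ y : ℝ, (y : ℂ) ∈ Metric.ball (x : ℂ) r → f y = g y) : FlatExt O g x r := by
  obtain ⟨G, h1, h2, h3⟩ := h
  exact ⟨G, h1, h2, fun y hy => (h3 y hy).trans (hfg y hy)⟩

theorem FlatExt.sub {O : Set ℂ} {f g : ℝ → ℂ} {x r : ℝ} (hf : FlatExt O f x r)
    (hg : FlatExt O g x r) : FlatExt O (fun y => f y - g y) x r := by
  obtain ⟨F, h1, h2, h3⟩ := hf
  obtain ⟨G, k1, k2, k3⟩ := hg
  exact ⟨fun z => F z - G z, h1.sub k1, h2.sub k2, fun y hy => by simp only [h3 y hy, k3 y hy]⟩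

theorem FlatExt.const_mul {O : Set ℂ} {f : ℝ → ℂ} {x r : ℝ} (c : ℂ) (hf : FlatExt O f x r) :
    FlatExt O (fun y => c * f y) x r := by
  obtain ⟨F, h1, h2, h3⟩ := hf
  exact ⟨fun z => c * F z, continuousOn_const.mul h1, h2.const_mul c,
    fun y hy => by simp only [h3 y hy]⟩

theorem BddFlatExt.flatExt {O : Set ℂ} {f : ℝ → ℂ} {x r M : ℝ} (h : BddFlatExt O f x r M) :
    FlatExt O f x r := by
  obtain ⟨G, h1, h2, -, h4⟩ := h
  exact ⟨G, h1.mono (inter_subset_inter_left _ Metric.ball_subset_closedBall), h2,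
    fun y hy => h4 y (Metric.ball_subset_closedBall hy)⟩

theorem FlatExt.exists_bddFlatExt {O : Set ℂ} (hO : O ∈ flatRegions) {f : ℝ → ℂ}
    {x r x' r' : ℝ} (h : FlatExt O f x r)
    (hb : Metric.closedBall (x' : ℂ) r' ⊆ Metric.ball (x : ℂ) r) :
    ∃ M : ℕ, BddFlatExt O f x' r' M := by
  obtain ⟨G, h1, h2, h3⟩ := h
  have hc := h1.mono (inter_subset_inter_left (withLine O) hb)
  obtain ⟨C, hC⟩ := ((isCompact_closedBall (x' : ℂ) r').inter_right
    (isClosed_withLine hO)).exists_bound_of_continuousOn hc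
  obtain ⟨M, hM⟩ := exists_nat_ge C
  exact ⟨M, G, hc, h2.mono (inter_subset_inter_left _ (Metric.ball_subset_closedBall.trans hb)),
    fun z hz => (hC z hz).trans hM, fun y hy => h3 y (hb hy)⟩

/-! ### Limits of extendable functions -/

/-- Applied to differences of extensions, the two-constants estimate turns uniform convergence on
the diameter into uniform convergence on the smaller disc. The common bound `M` is essential. -/
theorem flatExt_of_approx {O : Set ℂ} (hO : O ∈ flatRegions) {f : ℝ → ℂ} {x r M : ℝ} (hr : 0 < r)
    (h : ∀ ε > 0, ∃ g : ℝ → ℂ, BddFlatExt O g x r M ∧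
      ∀ s : ℝ, (s : ℂ) ∈ Metric.closedBall (x : ℂ) r → ‖g s - f s‖ ≤ ε) :
    FlatExt O f x (r / 9) := by
  choose g hg hgf using fun n : ℕ => h (1 / ((n : ℝ) + 1)) (by positivity)
  choose G hc hd hb hG using hg
  set S := Metric.ball (x : ℂ) (r / 9) ∩ withLine O with hS
  have hSsub : S ⊆ Metric.closedBall (x : ℂ) r ∩ withLine O :=
    inter_subset_inter_left _ ((Metric.ball_subset_ball (by linarith)).trans
      Metric.ball_subset_closedBall)
  -- With `K` at least 1, the small constant 2/(N+1) stays below the large one 2K, as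
  -- `two_constants` requires.
  set K : ℝ := max M 1 with hK
  have hMK : M ≤ K := le_max_left _ _
  have h1K : 1 ≤ K := le_max_right _ _
  have hcauchy : UniformCauchySeqOn G atTop S := by
    rw [Metric.uniformCauchySeqOn_iff]
    intro ε hε
    obtain ⟨N, hN⟩ := exists_nat_gt (4 * K / ε ^ 2)
    refine ⟨N, fun m hm n hn z hz => ?_⟩
    have hbd : ∀ k ≥ N, ∀ s : ℝ, (s : ℂ) ∈ Metric.closedBall (x : ℂ) r →
        ‖g k s - f s‖ ≤ 1 / ((N : ℝ) + 1) := by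
      intro k hk s hs
      refine (hgf k s hs).trans ?_
      have : (N : ℝ) ≤ k := by exact_mod_cast hk
      gcongr
    have hN1 : 1 / ((N : ℝ) + 1) ≤ 1 := by
      rw [div_le_one (by positivity)]; linarith [(Nat.cast_nonneg N : (0 : ℝ) ≤ N)]
    have key := two_constants hO (G := fun z => G m z - G n z) (M := 2 * K)
      (δ := 2 * (1 / ((N : ℝ) + 1))) hr (by positivity) (by linarith)
      ((hc m).sub (hc n)) ((hd m).sub (hd n))
      (fun w hw => (norm_sub_le _ _).trans (by linarith [hb m w hw, hb n w hw]))
      (fun s hs => by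
        simp only [hG m s hs, hG n s hs]
        have e : g m s - g n s = (g m s - f s) - (g n s - f s) := by ring
        rw [e]
        exact (norm_sub_le _ _).trans (by linarith [hbd m hm s hs, hbd n hn s hs])) hz
    rw [dist_eq_norm]
    have h2 : 2 * K * (2 * (1 / ((N : ℝ) + 1))) < ε ^ 2 := by
      have e : 2 * K * (2 * (1 / ((N : ℝ) + 1))) = 4 * K / ((N : ℝ) + 1) := by ring
      rw [e, div_lt_iff₀ (by positivity)]
      rw [div_lt_iff₀ (by positivity)] at hN
      nlinarith [sq_nonneg ε]
    exact lt_of_pow_lt_pow_left₀ 2 hε.le (key.trans_lt h2)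
  have hlim : ∀ z ∈ S, ∃ l, Tendsto (fun n => G n z) atTop (𝓝 l) := fun z hz =>
    cauchySeq_tendsto_of_complete (hcauchy.cauchySeq hz)
  choose! F hF using hlim
  have hunif : TendstoUniformlyOn G F atTop S := hcauchy.tendstoUniformlyOn_of_tendsto hF
  refine ⟨F, ?_, ?_, ?_⟩
  · exact hunif.continuousOn (Frequently.of_forall fun n => (hc n).mono hSsub)
  · have hsub : Metric.ball (x : ℂ) (r / 9) ∩ O ⊆ S := inter_subset_inter_right _ subset_union_left
    refine (hunif.mono hsub).tendstoLocallyUniformlyOn.differentiableOn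
      (Eventually.of_forall fun n => (hd n).mono
        (inter_subset_inter_left _ (Metric.ball_subset_ball (by linarith))))
      (Metric.isOpen_ball.inter (isOpen_of_mem_flatRegions hO))
  · intro y hy
    have hyS : (y : ℂ) ∈ S := ⟨hy, Or.inr (Complex.ofReal_im y)⟩
    have hyb := (hSsub hyS).1
    refine tendsto_nhds_unique (hF y hyS) ?_
    simp only [hG _ y hyb]
    rw [tendsto_iff_norm_sub_tendsto_zero]
    exact squeeze_zero (fun _ => norm_nonneg _) (fun n => hgf n y hyb)
      tendsto_one_div_add_atTop_nhds_zero_nat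

theorem closure_bddFlatExt_subset {Y : Type*} [TopologicalSpace Y] {Φ : Y → ℝ → ℂ} {O : Set ℂ}
    (hO : O ∈ flatRegions) {x r M : ℝ} (hr : 0 < r)
    (hΦ : ∀ y, ∀ ε > 0, ∀ᶠ y' in 𝓝 y, ∀ s : ℝ, (s : ℂ) ∈ Metric.closedBall (x : ℂ) r →
      ‖Φ y' s - Φ y s‖ ≤ ε) :
    closure {y | BddFlatExt O (Φ y) x r M} ⊆ {y | FlatExt O (Φ y) x (r / 9)} := by
  intro y hy
  refine flatExt_of_approx hO hr (M := M) fun ε hε => ?_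
  obtain ⟨y', h1, h2⟩ := ((mem_closure_iff_frequently.1 hy).and_eventually (hΦ y ε hε)).exists
  exact ⟨Φ y', h1, h2⟩

/-! ### Uniqueness -/

/-- Boundary uniqueness without reflection: letting `δ` tend to 0 in the two-constants estimate
kills the extension near the middle of the interval. The identity theorem spreads this over the
convex set ball ∩ `O`, and continuity returns it to the axis. -/
theorem FlatExt.eq_zero_of_eq_zero {O : Set ℂ} (hO : O ∈ flatRegions) {f : ℝ → ℂ} {x r c d : ℝ}
    (h : FlatExt O f x r) (hcd : c < d) (hc : x - r < c) (hd : d < x + r)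
    (h0 : ∀ y ∈ Ioo c d, f y = 0) {y : ℝ} (hy : |y - x| < r) : f y = 0 := by
  obtain ⟨G, hGc, hGd, hG⟩ := h
  set m : ℝ := (c + d) / 2 with hm
  set ρ : ℝ := (d - c) / 4 with hρ
  have hρ0 : 0 < ρ := by rw [hρ]; linarith
  have hsub : Metric.closedBall (m : ℂ) ρ ⊆ Metric.ball (x : ℂ) r := by
    apply Metric.closedBall_subset_ball'
    rw [dist_eq_norm, ← Complex.ofReal_sub, Complex.norm_real, Real.norm_eq_abs]
    have : |m - x| < r - ρ := by rw [abs_lt, hm, hρ]; constructor <;> linarith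
    linarith
  have hcK := hGc.mono (inter_subset_inter_left (withLine O) hsub)
  obtain ⟨C, hC⟩ := ((isCompact_closedBall (m : ℂ) ρ).inter_right
    (isClosed_withLine hO)).exists_bound_of_continuousOn hcK
  have hzero : ∀ z ∈ Metric.ball (m : ℂ) (ρ / 9) ∩ withLine O, G z = 0 := by
    intro z hz
    have hsq : ‖G z‖ ^ 2 ≤ 0 := by
      refine le_of_forall_pos_le_add fun ε hε => ?_
      set K := max C 1 with hK
      have hCK : C ≤ K := le_max_left _ _
      have h1K : 1 ≤ K := le_max_right _ _
      -- The two constants are chosen to have product `ε`.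
      have := two_constants hO (M := K + ε) (δ := ε / (K + ε)) hρ0 (by positivity)
        (by rw [div_le_iff₀ (by positivity)]; nlinarith) hcK
        (hGd.mono (inter_subset_inter_left _ (Metric.ball_subset_closedBall.trans hsub)))
        (fun z hz => (hC z hz).trans (by linarith))
        (fun s hs => by
          rw [hG s (hsub hs), h0 s, norm_zero]
          · positivity
          · rw [ofReal_mem_closedBall, abs_le, hm, hρ] at hs
            constructor <;> linarith [hs.1, hs.2]) hz
      rw [mul_div_cancel₀ _ (by positivity)] at this
      linarith
    have : ‖G z‖ = 0 := by nlinarith [norm_nonneg (G z)]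
    exact norm_eq_zero.1 this
  have hOo := isOpen_of_mem_flatRegions hO
  have hopen : IsOpen (Metric.ball (x : ℂ) r ∩ O) := Metric.isOpen_ball.inter hOo
  have hline : ∀ y : ℝ, (y : ℂ) ∈ closure O := by
    intro y
    rcases hO with rfl | rfl | rfl
    · have : closure upperSide = {z : ℂ | 0 ≤ z.im} := Complex.closure_setOfPred_lt_im 0
      rw [this]; simp
    · have : closure lowerSide = {z : ℂ | z.im ≤ 0} := Complex.closure_setOfPred_im_lt 0
      rw [this]; simp
    · simp
  have hmem : ∀ {y t s : ℝ}, |y - t| < s →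
      (y : ℂ) ∈ closure (Metric.ball (t : ℂ) s ∩ O) := fun {y t s} hy =>
    Metric.isOpen_ball.inter_closure ⟨ofReal_mem_ball.2 hy, hline y⟩
  obtain ⟨z₀, hz₀⟩ : (Metric.ball (m : ℂ) (ρ / 9) ∩ O).Nonempty :=
    closure_nonempty_iff.1 ⟨m, hmem (by simpa using hρ0)⟩
  have hz₀' : z₀ ∈ Metric.ball (x : ℂ) r ∩ O :=
    ⟨hsub (Metric.ball_subset_closedBall (Metric.ball_subset_ball (by linarith) hz₀.1)), hz₀.2⟩
  have hEq : EqOn G 0 (Metric.ball (x : ℂ) r ∩ O) := by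
    refine (hGd.analyticOnNhd hopen).eqOn_zero_of_preconnected_of_eventuallyEq_zero
      ((convex_ball _ _).inter (convex_of_mem_flatRegions hO)).isPreconnected hz₀' ?_
    filter_upwards [(Metric.isOpen_ball.inter hOo).mem_nhds hz₀] with z hz
    exact hzero z ⟨hz.1, Or.inl hz.2⟩
  rw [← hG y (ofReal_mem_ball.2 hy)]
  have hyb : (y : ℂ) ∈ Metric.ball (x : ℂ) r ∩ withLine O :=
    ⟨ofReal_mem_ball.2 hy, Or.inr (Complex.ofReal_im y)⟩
  have hcont : ContinuousWithinAt G (Metric.ball (x : ℂ) r ∩ O) y :=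
    (hGc y hyb).mono (inter_subset_inter_right _ subset_union_left)
  have := (mem_closure_iff_nhdsWithin_neBot.1 (hmem hy))
  refine tendsto_nhds_unique hcont.tendsto (tendsto_const_nhds.congr' ?_)
  filter_upwards [self_mem_nhdsWithin] with z hz using (hEq hz).symm

/-! ### A smooth function that extends nowhere -/

/-- A diagonal choice: the weight of the n-th index absorbs the bounds of orders up to n, so each
order `l` is controlled by a geometric series outside finitely many indices. -/
theorem exists_weights {I : Type*} [Encodable I] (B : ℕ → I → ℝ) (hB : ∀ l p, 0 ≤ B l p) :
    ∃ a : I → ℝ, (∀ p, 0 < a p) ∧ ∀ l, Summable fun p => a p * B l p := by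
  have hS : ∀ p, 0 ≤ ∑ l ∈ Finset.range (Encodable.encode p + 1), B l p := fun p =>
    Finset.sum_nonneg fun l _ => hB l p
  refine ⟨fun p => (1 / 2) ^ Encodable.encode p /
    (1 + ∑ l ∈ Finset.range (Encodable.encode p + 1), B l p), fun p => ?_, fun l => ?_⟩
  · have := hS p
    positivity
  · refine Summable.of_norm_bounded_eventually summable_geometric_two_encode ?_
    have hfin : {p : I | Encodable.encode p < l}.Finite :=
      (finite_lt_nat l).preimage (Encodable.encode_injective.injOn)
    filter_upwards [hfin.compl_mem_cofinite] with p hp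
    have hlp : l ≤ Encodable.encode p := not_lt.1 hp
    have h1 : B l p ≤ ∑ l ∈ Finset.range (Encodable.encode p + 1), B l p :=
      Finset.single_le_sum (f := fun l => B l p) (fun l _ => hB l p)
        (Finset.mem_range.2 (Nat.lt_succ_of_le hlp))
    have := hS p
    rw [Real.norm_of_nonneg (mul_nonneg (by positivity) (hB l p)), div_mul_eq_mul_div,
      div_le_iff₀ (by positivity)]
    gcongr
    linarith

/-- Smooth bumps, one for each closed interval with rational centre and radius contained in `R`,
with summable derivatives of all orders. -/
theorem exists_bumps (R : Set ℝ) :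
    ∃ (ψ : ℚ × ℚ → ℝ → ℂ) (v : ℕ → ℚ × ℚ → ℝ),
      (∀ p, ContDiff ℝ ∞ (ψ p)) ∧ (∀ p, HasCompactSupport (ψ p)) ∧ (∀ p, tsupport (ψ p) ⊆ R) ∧
      (∀ l, Summable (v l)) ∧ (∀ l p y, ‖iteratedFDeriv ℝ l (ψ p) y‖ ≤ v l p) ∧
      ∀ p : ℚ × ℚ, 0 < p.2 → Metric.closedBall (p.1 : ℝ) p.2 ⊆ R →
        ψ p p.1 ≠ 0 ∧ ∀ y ∈ Ioo (p.1 + p.2 / 18 : ℝ) (p.1 + p.2 / 9), ψ p y = 0 := by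
  have hφ : ∀ p : ℚ × ℚ, ∃ φ : ℝ → ℂ, ContDiff ℝ ∞ φ ∧ HasCompactSupport φ ∧ tsupport φ ⊆ R ∧
      (0 < p.2 → Metric.closedBall (p.1 : ℝ) p.2 ⊆ R →
        φ p.1 ≠ 0 ∧ ∀ y ∈ Ioo (p.1 + p.2 / 18 : ℝ) (p.1 + p.2 / 9), φ y = 0) := by
    intro p
    by_cases hp : 0 < p.2 ∧ Metric.closedBall (p.1 : ℝ) p.2 ⊆ R
    · have hp2 : (0 : ℝ) < p.2 := by exact_mod_cast hp.1
      -- The support radius is below `p.2 / 9`, the radius surviving in `flatExt_of_approx`, so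
      -- uniqueness on that smaller disc rules out an extension.
      let b : ContDiffBump (p.1 : ℝ) := ⟨p.2 / 27, p.2 / 18, by positivity, by linarith⟩
      have hsupp : Function.support (fun y => (b y : ℂ)) = Metric.ball (p.1 : ℝ) (p.2 / 18) := by
        rw [← b.support_eq]; ext y; simp
      have hts : tsupport (fun y => (b y : ℂ)) ⊆ Metric.closedBall (p.1 : ℝ) (p.2 / 18) := by
        rw [tsupport, hsupp]; exact Metric.closure_ball_subset_closedBall
      refine ⟨fun y => (b y : ℂ), Complex.ofRealCLM.contDiff.comp b.contDiff,
        HasCompactSupport.of_support_subset_isCompact (isCompact_closedBall _ _)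
          ((subset_tsupport _).trans hts),
        hts.trans ((Metric.closedBall_subset_closedBall (by linarith)).trans hp.2),
        fun _ _ => ⟨?_, fun y hy => ?_⟩⟩
      · have : b (p.1 : ℝ) = 1 :=
          b.one_of_mem_closedBall (Metric.mem_closedBall_self b.rIn_pos.le)
        simp [this]
      · by_contra hne
        have : y ∈ Metric.ball (p.1 : ℝ) (p.2 / 18) := hsupp ▸ hne
        rw [Metric.mem_ball, Real.dist_eq, abs_lt] at this
        linarith [hy.1]
    · exact ⟨0, contDiff_const, HasCompactSupport.zero, by simp,
        fun h1 h2 => absurd ⟨h1, h2⟩ hp⟩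
  choose φ hφs hφc hφR hφ using hφ
  have hB : ∀ (l : ℕ) (p : ℚ × ℚ), ∃ C, 0 ≤ C ∧ ∀ y, ‖iteratedFDeriv ℝ l (φ p) y‖ ≤ C := by
    intro l p
    obtain ⟨C, hC⟩ := ((hφc p).iteratedFDeriv (𝕜 := ℝ) l).exists_bound_of_continuous
      ((hφs p).continuous_iteratedFDeriv (by exact_mod_cast le_top))
    exact ⟨C, (norm_nonneg _).trans (hC 0), hC⟩
  choose B hB0 hB using hB
  obtain ⟨a, ha, hsum⟩ := exists_weights B hB0
  refine ⟨fun p => a p • φ p, fun l p => a p * B l p, fun p => contDiff_const.smul (hφs p),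
    fun p => (hφc p).smul_left (f := fun _ => a p), fun p => ?_, hsum, fun l p y => ?_,
    fun p h1 h2 => ⟨?_, fun y hy => ?_⟩⟩
  · exact (tsupport_smul_subset_right (fun _ => a p) (φ p)).trans (hφR p)
  · rw [iteratedFDeriv_const_smul_apply ((hφs p).contDiffAt.of_le (by exact_mod_cast le_top)),
      norm_smul, Real.norm_of_nonneg (ha p).le]
    exact mul_le_mul_of_nonneg_left (hB l p y) (ha p).le
  · exact smul_ne_zero (ha p).ne' (hφ p h1 h2).1
  · simp [(hφ p h1 h2).2 y hy]

/-- Extendability at some point of an open set is detected on rational discs. -/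
theorem FlatExt.exists_rat {O : Set ℂ} (hO : O ∈ flatRegions) {R : Set ℝ} (hR : IsOpen R)
    {f : ℝ → ℂ} {x r : ℝ} (hx : x ∈ R) (hr : 0 < r) (h : FlatExt O f x r) :
    ∃ (p : ℚ × ℚ) (M : ℕ), 0 < p.2 ∧ Metric.closedBall (p.1 : ℝ) p.2 ⊆ R ∧
      BddFlatExt O f p.1 p.2 M := by
  obtain ⟨s, hs, hsR⟩ := Metric.isOpen_iff.1 hR x hx
  set ρ := min r s with hρ
  have hρ0 : 0 < ρ := lt_min hr hs
  obtain ⟨q, hq1, hq2⟩ := exists_rat_btwn (show x - ρ / 4 < x + ρ / 4 by linarith)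
  obtain ⟨t, ht1, ht2⟩ := exists_rat_btwn (show ρ / 4 < ρ / 2 by linarith)
  have hqx : |(q : ℝ) - x| < ρ / 2 := by rw [abs_lt]; constructor <;> linarith
  obtain ⟨M, hM⟩ := h.exists_bddFlatExt hO (x' := q) (r' := t) (by
    apply Metric.closedBall_subset_ball'
    rw [dist_eq_norm, ← Complex.ofReal_sub, Complex.norm_real, Real.norm_eq_abs]
    linarith [min_le_left r s])
  refine ⟨(q, t), M, ?_, ?_, hM⟩
  · have : (0 : ℝ) < t := by linarith
    exact_mod_cast this
  · refine Subset.trans ?_ hsR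
    apply Metric.closedBall_subset_ball'
    rw [Real.dist_eq]
    linarith [min_le_right r s]

/-- `W` is a series of bumps with coefficients in ℓ^∞. Were there no good coefficients, Baire would
give a bad closed set with interior; two of its points differing in one coefficient would make a
single bump extend. The filter `𝓕` expresses tending to the ends of `R` in a form that can be pulled
back to the curve. -/
theorem exists_nowhere_flatExt {R : Set ℝ} (hR : IsOpen R) :
    ∃ W : ℝ → ℂ, ContDiff ℝ ∞ W ∧ (∀ y ∉ R, W y = 0) ∧
      (∀ l : ℕ, ∃ C, ∀ y, ‖iteratedDeriv l W y‖ ≤ C) ∧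
      (∀ (l : ℕ) (𝓕 : Filter ℝ), (∀ K ⊆ R, IsCompact K → Kᶜ ∈ 𝓕) →
        Tendsto (iteratedDeriv l W) 𝓕 (𝓝 0)) ∧
      ∀ O ∈ flatRegions, ∀ x ∈ R, ∀ r > 0, ¬ FlatExt O W x r := by
  obtain ⟨ψ, v, hψs, hψc, hψR, hv, hψv, hψ⟩ := exists_bumps R
  have hv0 : ∀ l p, 0 ≤ v l p := fun l p => (norm_nonneg _).trans (hψv l p 0)
  let A := lp (fun _ : ℚ × ℚ => ℂ) ⊤
  let w : A → ℝ → ℂ := fun c y => ∑' p, (c p • ψ p) y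
  have hcb : ∀ (c : A) (p), ‖c p‖ ≤ ‖c‖ := lp.norm_apply_le_norm (by simp)
  have hsm : ∀ (c : A) (p), ContDiff ℝ ∞ (c p • ψ p) := fun c p => contDiff_const.smul (hψs p)
  have hbd : ∀ (c : A) (l : ℕ) (p) (y : ℝ),
      ‖iteratedFDeriv ℝ l (c p • ψ p) y‖ ≤ ‖c‖ * v l p := by
    intro c l p y
    rw [iteratedFDeriv_const_smul_apply ((hψs p).contDiffAt.of_le (by exact_mod_cast le_top)),
      norm_smul]
    exact mul_le_mul (hcb c p) (hψv l p y) (norm_nonneg _) (norm_nonneg _)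
  have hbd0 : ∀ (c : A) (p) (y : ℝ), ‖(c p • ψ p) y‖ ≤ ‖c‖ * v 0 p := by
    intro c p y
    simpa using hbd c 0 p y
  have hsum : ∀ (c : A) (y : ℝ), Summable fun p => (c p • ψ p) y := fun c y =>
    Summable.of_norm_bounded ((hv 0).mul_left ‖c‖) fun p => hbd0 c p y
  have hwsub : ∀ (c c' : A) (y : ℝ), w c y - w c' y = w (c - c') y := by
    intro c c' y
    simp only [w]
    rw [← (hsum c y).tsum_sub (hsum c' y)]
    refine tsum_congr fun p => ?_
    simp [sub_mul]
  have hwbd : ∀ (c : A) (y : ℝ), ‖w c y‖ ≤ ‖c‖ * ∑' p, v 0 p := by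
    intro c y
    rw [← tsum_mul_left]
    exact tsum_of_norm_bounded ((hv 0).mul_left ‖c‖).hasSum fun p => hbd0 c p y
  have hV : 0 ≤ ∑' p, v 0 p := tsum_nonneg (hv0 0)
  have hder : ∀ (c : A) (l : ℕ) (y : ℝ),
      iteratedFDeriv ℝ l (w c) y = ∑' p, iteratedFDeriv ℝ l (c p • ψ p) y := fun c l y =>
    congrFun (iteratedFDeriv_tsum (N := ⊤) (hsm c) (fun l _ => (hv l).mul_left ‖c‖)
      (fun l p y _ => hbd c l p y) (k := l) le_top) y
  obtain ⟨c, hc⟩ : ∃ c : A, ∀ O ∈ flatRegions, ∀ (p : ℚ × ℚ) (M : ℕ), 0 < p.2 →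
      Metric.closedBall (p.1 : ℝ) p.2 ⊆ R → ¬ BddFlatExt O (w c) p.1 p.2 M := by
    by_contra hcon
    push Not at hcon
    let I := flatRegions × {p : ℚ × ℚ // 0 < p.2 ∧ Metric.closedBall (p.1 : ℝ) p.2 ⊆ R} × ℕ
    have : Countable flatRegions := countable_flatRegions.to_subtype
    let bad : I → Set A := fun i =>
      closure {c | BddFlatExt i.1 (w c) i.2.1.1.1 i.2.1.1.2 i.2.2}
    obtain ⟨⟨⟨O, hO⟩, ⟨p, hp, hpR⟩, M⟩, c, hcint⟩ :=
      nonempty_interior_of_iUnion_of_closed (f := bad) (fun i => isClosed_closure) (by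
        refine eq_univ_of_forall fun c => ?_
        obtain ⟨O, hO, p, M, hp, hpR, hext⟩ := hcon c
        exact mem_iUnion.2 ⟨(⟨O, hO⟩, ⟨p, hp, hpR⟩, M), subset_closure hext⟩)
    have hp' : (0 : ℝ) < p.2 := by exact_mod_cast hp
    have hsub : ∀ c ∈ bad (⟨O, hO⟩, ⟨p, hp, hpR⟩, M), FlatExt O (w c) p.1 (p.2 / 9) := by
      refine closure_bddFlatExt_subset hO hp' fun c ε hε => ?_
      have hlim : Tendsto (fun c' : A => ‖c' - c‖ * ∑' p, v 0 p) (𝓝 c) (𝓝 0) := by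
        have : Continuous fun c' : A => ‖c' - c‖ * ∑' p, v 0 p := by fun_prop
        simpa using this.tendsto c
      filter_upwards [hlim.eventually (gt_mem_nhds hε)] with c' hc' s _
      rw [hwsub]
      exact (hwbd _ s).trans hc'.le
    obtain ⟨η, hη, hball⟩ := Metric.isOpen_iff.1 isOpen_interior c hcint
    -- Only the coefficient of the bump attached to the disc `p` is changed, by an amount that stays
    -- inside the ball of radius `η`.
    let e : A := lp.single ⊤ p ((η / 2 : ℝ) : ℂ)
    have hmem : c + e ∈ interior (bad (⟨O, hO⟩, ⟨p, hp, hpR⟩, M)) := by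
      apply hball
      rw [mem_ball_iff_norm, add_sub_cancel_left, lp.norm_single (by simp), Complex.norm_real,
        Real.norm_of_nonneg (by positivity)]
      linarith
    have hext := (hsub _ (interior_subset hmem)).sub (hsub _ (interior_subset hcint))
    have hwe : ∀ y, w e y = (η / 2 : ℝ) * ψ p y := by
      intro y
      simp only [w]
      rw [tsum_eq_single p]
      · simp [e]
      · intro p' hp'
        simp [e, hp']
    simp only [hwsub, add_sub_cancel_left, hwe] at hext
    obtain ⟨h1, h2⟩ := hψ p hp hpR
    -- The right end uses 1/10 because the interval must end strictly inside the disc of radius `p.2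
    -- / 9`.
    have := hext.eq_zero_of_eq_zero hO (c := p.1 + p.2 / 18) (d := p.1 + p.2 / 10)
      (by linarith) (by linarith) (by linarith)
      (fun y hy => by rw [h2 y ⟨hy.1, by linarith [hy.2]⟩, mul_zero]) (y := p.1) (by
        rw [sub_self, abs_zero]; positivity)
    refine h1 ((mul_eq_zero.1 this).resolve_left ?_)
    exact_mod_cast (half_pos hη).ne'
  refine ⟨w c, ?_, fun y hy => ?_, fun l => ⟨∑' p, ‖c‖ * v l p, fun y => ?_⟩,
    fun l 𝓕 h𝓕 => ?_, fun O hO x hx r hr hext => ?_⟩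
  · exact contDiff_tsum (N := ⊤) (hsm c) (fun l _ => (hv l).mul_left ‖c‖)
      (fun l p y _ => hbd c l p y)
  · have : ∀ p, (c p • ψ p) y = 0 := fun p => by
      have : ψ p y = 0 := image_eq_zero_of_notMem_tsupport fun h => hy (hψR p h)
      simp [this]
    simp only [w, this, tsum_zero]
  · rw [← norm_iteratedFDeriv_eq_norm_iteratedDeriv, hder]
    exact tsum_of_norm_bounded ((hv l).mul_left ‖c‖).hasSum fun p => hbd c l p y
  · rw [tendsto_zero_iff_norm_tendsto_zero]
    simp only [← norm_iteratedFDeriv_eq_norm_iteratedDeriv, hder]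
    rw [← tendsto_zero_iff_norm_tendsto_zero]
    -- Each bump has compact support in `R`, so each term is eventually zero along `𝓕`.
    have := tendsto_tsum_of_dominated_convergence (𝓕 := 𝓕)
      (f := fun y p => iteratedFDeriv ℝ l (c p • ψ p) y) (g := fun _ => 0)
      ((hv l).mul_left ‖c‖) (fun p => ?_) (Eventually.of_forall fun y p => hbd c l p y)
    · simpa using this
    · refine tendsto_const_nhds.congr' ?_
      filter_upwards [h𝓕 _ (hψR p) (hψc p)] with y hy
      have hsupp : tsupport (c p • ψ p) ⊆ tsupport (ψ p) :=
        tsupport_smul_subset_right (fun _ => c p) (ψ p)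
      exact (image_eq_zero_of_notMem_tsupport fun h =>
        hy (hsupp (tsupport_iteratedFDeriv_subset l h))).symm
  · obtain ⟨p, M, h1, h2, h3⟩ := hext.exists_rat hO hR hx hr
    exact hc O hO p M h1 h2 h3

/-! ### Genericity in the flat model -/

section Generic

variable {X : Type}

/-- The functions that, in the coordinate `t`, extend to none of the regions in `𝒪` at any point. -/
def FlatNonext (t : X → ℝ) (𝒪 : Set (Set ℂ)) : Set (X → ℂ) :=
  {u | ∀ O ∈ 𝒪, ∀ x : X, ∀ r > 0, ¬ FlatExt O (inCoord t u) (t x) r}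

theorem countable_setOf_flatExt_add {R : Set ℝ} (hR : IsOpen R) {W : ℝ → ℂ}
    (hW : ∀ O ∈ flatRegions, ∀ x ∈ R, ∀ r > 0, ¬ FlatExt O W x r) (f : ℝ → ℂ) :
    {ε : ℝ | ∃ O ∈ flatRegions, ∃ x ∈ R, ∃ r > 0,
      FlatExt O (fun y => f y + ε * W y) x r}.Countable := by
  have hsub : {ε : ℝ | ∃ O ∈ flatRegions, ∃ x ∈ R, ∃ r > 0,
      FlatExt O (fun y => f y + ε * W y) x r} ⊆
      ⋃ O ∈ flatRegions, ⋃ p : {p : ℚ × ℚ // 0 < p.2 ∧ Metric.closedBall (p.1 : ℝ) p.2 ⊆ R},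
        {ε : ℝ | FlatExt O (fun y => f y + ε * W y) p.1.1 p.1.2} := by
    rintro ε ⟨O, hO, x, hx, r, hr, h⟩
    obtain ⟨p, M, h1, h2, h3⟩ := h.exists_rat hO hR hx hr
    simp only [mem_iUnion]
    exact ⟨O, hO, ⟨p, h1, h2⟩, h3.flatExt⟩
  refine Countable.mono hsub (countable_flatRegions.biUnion fun O hO =>
    countable_iUnion fun ⟨p, hp, hpR⟩ => Subsingleton.countable fun ε hε ε' hε' => ?_)
  by_contra hne
  have hp' : (0 : ℝ) < p.2 := by exact_mod_cast hp
  refine hW O hO p.1 (hpR (Metric.mem_closedBall_self hp'.le)) p.2 hp' ?_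
  have hne' : (ε : ℂ) - ε' ≠ 0 := by
    rw [sub_ne_zero]; exact_mod_cast hne
  refine ((FlatExt.sub hε hε').const_mul ((ε : ℂ) - ε')⁻¹).congr fun y _ => ?_
  field_simp
  ring

theorem mem_closure_of_countable_path {Y : Type*} [TopologicalSpace Y] {D : Set Y} {u : Y}
    (p : ℝ → Y) (hp : Tendsto p (𝓝 0) (𝓝 u)) (hD : {ε : ℝ | p ε ∉ D}.Countable) :
    u ∈ closure D := by
  rw [mem_closure_iff_frequently]
  have : ∃ᶠ ε in 𝓝 (0 : ℝ), p ε ∈ D := by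
    have := mem_closure_iff_frequently.1 (hD.dense_compl ℝ 0)
    simpa using this
  exact hp.frequently this

theorem inCoord_apply {t : X → ℝ} (ht : Function.Injective t) (u : X → ℂ) (x : X) :
    inCoord t u (t x) = u x := ht.extend_apply u 0 x

/-- Vanishing of `W` off the range matches the default value 0 of `inCoord`, so the identity holds
on all of ℝ. -/
theorem inCoord_add_mul {t : X → ℝ} (ht : Function.Injective t) {W : ℝ → ℂ}
    (hW : ∀ y ∉ range t, W y = 0) (u : X → ℂ) (ε : ℝ) :
    inCoord t (fun x => u x + ε * W (t x)) = fun y => inCoord t u y + ε * W y := by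
  funext y
  by_cases hy : y ∈ range t
  · obtain ⟨x, rfl⟩ := hy
    simp only [inCoord_apply ht]
  · simp [inCoord, Function.extend_apply' _ _ _ hy, hW y hy]

theorem curveDeriv_add_mul {t : X → ℝ} (ht : Function.Injective t) (hto : IsOpen (range t))
    {W : ℝ → ℂ} (hWs : ContDiff ℝ ∞ W) (hW : ∀ y ∉ range t, W y = 0) {k : ℕ∞} (u : Ck t k)
    (ε : ℝ) {l : ℕ} (hl : (l : ℕ∞) ≤ k) (x : X) :
    curveDeriv t l (fun x => u.toFun x + ε * W (t x)) x =
      curveDeriv t l u.toFun x + ε * iteratedDeriv l W (t x) := by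
  have hWl : ContDiffAt ℝ l W (t x) := hWs.contDiffAt.of_le (by exact_mod_cast le_top)
  have hul : ContDiffAt ℝ l (inCoord t u.toFun) (t x) :=
    (u.contDiff.contDiffAt (hto.mem_nhds (mem_range_self x))).of_le (by exact_mod_cast hl)
  simp only [curveDeriv, inCoord_add_mul ht hW]
  rw [iteratedDeriv_fun_add hul (contDiffAt_const.mul hWl)]
  have := iteratedDeriv_const_smul hWl (ε : ℂ)
  simp only [smul_eq_mul] at this
  rw [← this]
  rfl

theorem Ckb.tendsto_iff {Y : Type*} {𝓕 : Filter Y} {t : X → ℝ} {k : ℕ∞} {p : Y → Ckb t k}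
    {u : Ckb t k} : Tendsto p 𝓕 (𝓝 u) ↔ ∀ l : ℕ, (l : ℕ∞) ≤ k →
      TendstoUniformly (fun y => curveDeriv t l (p y).toFun) (curveDeriv t l u.toFun) 𝓕 := by
  simp only [nhds_iInf, nhds_induced, tendsto_iInf, tendsto_comap_iff,
    UniformFun.tendsto_iff_tendstoUniformly]
  rfl

variable [TopologicalSpace X]

theorem Ck.tendsto_iff {Y : Type*} {𝓕 : Filter Y} {t : X → ℝ} {k : ℕ∞} {p : Y → Ck t k}
    {u : Ck t k} : Tendsto p 𝓕 (𝓝 u) ↔ ∀ l : ℕ, (l : ℕ∞) ≤ k → ∀ K : Set X, IsCompact K →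
      TendstoUniformlyOn (fun y => curveDeriv t l (p y).toFun) (curveDeriv t l u.toFun) 𝓕 K := by
  simp only [nhds_iInf, nhds_induced, tendsto_iInf, tendsto_comap_iff,
    UniformOnFun.tendsto_iff_tendstoUniformlyOn]
  rfl

theorem Ckb.continuous_toCk {t : X → ℝ} {k : ℕ∞} :
    Continuous (Ckb.toCk : Ckb t k → Ck t k) :=
  continuous_iff_continuousAt.2 fun _ => Ck.tendsto_iff.2 fun l hl _ _ =>
    (Ckb.tendsto_iff.1 tendsto_id l hl).tendstoUniformlyOn

/-- The sets of functions with bounded extension need not be closed, but their closures contain only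
extendable functions, so taking closures does not enlarge the union. -/
theorem isGδ_flatNonext {t : X → ℝ} (ht : IsOpenEmbedding t) (k : ℕ∞) {𝒪 : Set (Set ℂ)}
    (h𝒪 : 𝒪 ⊆ flatRegions) : IsGδ {u : Ck t k | u.toFun ∈ FlatNonext t 𝒪} := by
  have heq : {u : Ck t k | u.toFun ∈ FlatNonext t 𝒪} = ⋂ O ∈ 𝒪,
      ⋂ p : {p : ℚ × ℚ // 0 < p.2 ∧ Metric.closedBall (p.1 : ℝ) p.2 ⊆ range t}, ⋂ M : ℕ,
        (closure {u : Ck t k | BddFlatExt O (inCoord t u.toFun) p.1.1 p.1.2 M})ᶜ := by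
    ext u
    simp only [mem_iInter]
    refine ⟨fun hu O hO p M hcl => ?_, fun hu O hO x r hr hext => ?_⟩
    · obtain ⟨p, hp, hpR⟩ := p
      have hp' : (0 : ℝ) < p.2 := by exact_mod_cast hp
      obtain ⟨x, hx⟩ := hpR (Metric.mem_closedBall_self hp'.le)
      refine hu O hO x (p.2 / 9) (by positivity) ?_
      rw [hx]
      refine closure_bddFlatExt_subset (Φ := fun u : Ck t k => inCoord t u.toFun) (h𝒪 hO) hp'
        (fun u ε hε => ?_) hcl
      have hK : IsCompact (t ⁻¹' Metric.closedBall (p.1 : ℝ) p.2) := by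
        rw [ht.isInducing.isCompact_iff, image_preimage_eq_of_subset hpR]
        exact isCompact_closedBall _ _
      have := Ck.tendsto_iff.1 (tendsto_id (x := 𝓝 u)) 0 bot_le _ hK
      filter_upwards [Metric.tendstoUniformlyOn_iff.1 this ε hε] with u' hu' s hs
      have hs' : s ∈ Metric.closedBall (p.1 : ℝ) p.2 := by
        rw [Metric.mem_closedBall, Real.dist_eq]; exact ofReal_mem_closedBall.1 hs
      obtain ⟨x, rfl⟩ := hpR hs'
      have := hu' x hs'
      simp only [curveDeriv, iteratedDeriv_zero, id] at this
      rw [← dist_eq_norm, dist_comm]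
      exact this.le
    · obtain ⟨p, M, h1, h2, h3⟩ := hext.exists_rat (h𝒪 hO) ht.isOpen_range (mem_range_self x) hr
      exact hu O hO ⟨p, h1, h2⟩ M (subset_closure h3)
  rw [heq]
  exact IsGδ.biInter (countable_flatRegions.mono h𝒪) fun O _ =>
    IsGδ.iInter fun p => IsGδ.iInter fun M => isClosed_closure.isOpen_compl.isGδ

theorem denseGdeltaInSpaces_flatNonext {t : X → ℝ} (ht : IsOpenEmbedding t) (k : ℕ∞)
    {𝒪 : Set (Set ℂ)} (h𝒪 : 𝒪 ⊆ flatRegions) :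
    DenseGdeltaInSpaces t k (FlatNonext t 𝒪) := by
  have hG := isGδ_flatNonext ht k h𝒪
  have hGb : IsGδ {u : Ckb t k | u.toFun ∈ FlatNonext t 𝒪} :=
    IsGδ.preimage (s := {u : Ck t k | u.toFun ∈ FlatNonext t 𝒪}) Ckb.continuous_toCk hG
  obtain ⟨W, hWs, hW0, hWb, hWv, hWn⟩ := exists_nowhere_flatExt ht.isOpen_range
  have hinj := ht.injective
  have hWlim : ∀ l : ℕ, Tendsto (fun x => iteratedDeriv l W (t x)) (cocompact X) (𝓝 0) := by
    intro l
    refine hWv l (map t (cocompact X)) fun K hK hKc => ?_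
    have : IsCompact (t ⁻¹' K) := by
      rw [ht.isInducing.isCompact_iff, image_preimage_eq_of_subset hK]; exact hKc
    exact this.compl_mem_cocompact
  have hder : ∀ (u : Ck t k) (ε : ℝ) {l : ℕ}, (l : ℕ∞) ≤ k → ∀ x,
      curveDeriv t l (fun x => u.toFun x + ε * W (t x)) x =
        curveDeriv t l u.toFun x + ε * iteratedDeriv l W (t x) := fun u ε _ hl x =>
    curveDeriv_add_mul hinj ht.isOpen_range hWs hW0 u ε hl x
  let p : Ck t k → ℝ → Ck t k := fun u ε => ⟨fun x => u.toFun x + ε * W (t x), by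
    rw [inCoord_add_mul hinj hW0]
    exact u.contDiff.add (contDiff_const.mul (hWs.of_le (by exact_mod_cast le_top))).contDiffOn⟩
  let pb : Ckb t k → ℝ → Ckb t k := fun u ε => ⟨p u.toCk ε, fun l hl => by
    obtain ⟨C, hC⟩ := u.bounded l hl
    obtain ⟨C', hC'⟩ := hWb l
    refine ⟨C + |ε| * C', fun x => ?_⟩
    rw [hder u.toCk ε hl x]
    refine (norm_add_le _ _).trans (add_le_add (hC x) ?_)
    rw [norm_mul, Complex.norm_real, Real.norm_eq_abs]
    exact mul_le_mul_of_nonneg_left (hC' _) (abs_nonneg _)⟩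
  let p0 : Ck0 t k → ℝ → Ck0 t k := fun u ε => ⟨pb u.toCkb ε, fun l hl => by
    have := (u.vanishing l hl).add ((hWlim l).const_mul (ε : ℂ))
    rw [mul_zero, add_zero] at this
    exact this.congr fun x => (hder u.toCk ε hl x).symm⟩
  have hunif : ∀ (u : Ck t k) {l : ℕ}, (l : ℕ∞) ≤ k →
      TendstoUniformly (fun ε => curveDeriv t l (p u ε).toFun) (curveDeriv t l u.toFun)
        (𝓝 0) := by
    intro u l hl
    obtain ⟨C, hC⟩ := hWb l
    rw [Metric.tendstoUniformly_iff]
    intro η hη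
    have hlim : Tendsto (fun ε : ℝ => |ε| * C) (𝓝 0) (𝓝 0) := by
      have : Continuous fun ε : ℝ => |ε| * C := by fun_prop
      simpa using this.tendsto 0
    filter_upwards [hlim.eventually (gt_mem_nhds hη)] with ε hε x
    rw [dist_comm, dist_eq_norm, hder u ε hl x, add_sub_cancel_left, norm_mul, Complex.norm_real,
      Real.norm_eq_abs]
    exact (mul_le_mul_of_nonneg_left (hC _) (abs_nonneg _)).trans_lt hε
  have hp : ∀ u, Tendsto (p u) (𝓝 0) (𝓝 u) := fun u =>
    Ck.tendsto_iff.2 fun l hl _ _ => (hunif u hl).tendstoUniformlyOn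
  have hpb : ∀ u, Tendsto (pb u) (𝓝 0) (𝓝 u) := fun u =>
    Ckb.tendsto_iff.2 fun l hl => hunif u.toCk hl
  have hp0 : ∀ u, Tendsto (p0 u) (𝓝 0) (𝓝 u) := fun u => by
    rw [nhds_induced, tendsto_comap_iff]
    exact hpb u.toCkb
  have hcount : ∀ u : Ck t k, {ε : ℝ | (p u ε).toFun ∉ FlatNonext t 𝒪}.Countable := by
    intro u
    refine (countable_setOf_flatExt_add ht.isOpen_range hWn (inCoord t u.toFun)).mono ?_
    intro ε hε
    by_contra hcon
    refine hε fun O hO x r hr hext => hcon ⟨O, h𝒪 hO, t x, mem_range_self x, r, hr, ?_⟩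
    rwa [inCoord_add_mul hinj hW0] at hext
  exact ⟨⟨fun u => mem_closure_of_countable_path _ (hp u) (hcount u), hG⟩,
    ⟨fun u => mem_closure_of_countable_path _ (hpb u) (hcount u.toCk), hGb⟩,
    ⟨fun u => mem_closure_of_countable_path _ (hp0 u) (hcount u.toCk),
      IsGδ.preimage (s := {u : Ckb t k | u.toFun ∈ FlatNonext t 𝒪})
        continuous_induced_dom hGb⟩⟩

end Generic

/-! ### From the curve to the flat model -/

section Transfer

theorem exists_holomorphic_local_inverse {e : ℂ → ℂ} (he : Differentiable ℂ e) {a : ℂ}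
    (he' : deriv e a ≠ 0) :
    ∃ L : ℂ → ℂ, L (e a) = a ∧ (∀ᶠ w in 𝓝 (e a), DifferentiableAt ℂ L w) ∧
      (∀ᶠ w in 𝓝 (e a), e (L w) = w) ∧ ∀ᶠ z in 𝓝 a, L (e z) = z := by
  have hcd : ContDiff ℂ 1 e := he.contDiff
  have hs : HasStrictDerivAt e (deriv e a) a := hcd.contDiffAt.hasStrictDerivAt one_ne_zero
  refine ⟨hs.localInverse e _ a he', ?_, ?_, ?_, ?_⟩
  · exact (hs.hasStrictFDerivAt_equiv he').localInverse_apply_image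
  · have hL : ContDiffAt ℂ 1 (hs.localInverse e _ a he') (e a) :=
      hcd.contDiffAt.to_localInverse (f' := ContinuousLinearEquiv.unitsEquivAut ℂ
        (Units.mk0 (deriv e a) he')) (hs.hasStrictFDerivAt_equiv he').hasFDerivAt one_ne_zero
    exact (hL.eventually (by simp)).mono fun w hw => hw.differentiableAt one_ne_zero
  · exact (hs.hasStrictFDerivAt_equiv he').eventually_right_inverse
  · exact (hs.hasStrictFDerivAt_equiv he').eventually_left_inverse

variable {X : Type} [TopologicalSpace X]

theorem Ck.continuous_toFun {t : X → ℝ} (ht : IsOpenEmbedding t) {k : ℕ∞} (u : Ck t k) :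
    Continuous u.toFun := by
  have : u.toFun = inCoord t u.toFun ∘ t := by
    funext x; exact (inCoord_apply ht.injective u.toFun x).symm
  rw [this]
  exact u.contDiff.continuousOn.comp_continuous ht.continuous mem_range_self

theorem continuousOn_extend_range {ι : X → ℂ} (hι : IsEmbedding ι) {u : X → ℂ}
    (hu : Continuous u) : ContinuousOn (Function.extend ι u 0) (range ι) := by
  rintro _ ⟨x, rfl⟩
  rw [ContinuousWithinAt, ← hι.isInducing.map_nhds_eq, hι.injective.extend_apply]
  refine tendsto_map'_iff.2 ((hu.tendsto x).congr fun y => ?_)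
  exact (hι.injective.extend_apply u 0 y).symm

variable {t : X → ℝ} {ι : X → ℂ} {e : ℂ → ℂ} {S O : Set ℂ} {u : X → ℂ}

/-- A disc around a point of the curve on which the local inverse of the chart behaves well. -/
theorem exists_ball_local_inverse (ht : Continuous t) (hι : IsEmbedding ι)
    (hιe : ∀ x, ι x = e (t x)) (he : Differentiable ℂ e) (he' : ∀ z, deriv e z ≠ 0) (x : X)
    {r : ℝ} (hr : 0 < r) :
    ∃ L : ℂ → ℂ, ∃ s > 0, ∀ w ∈ Metric.ball (ι x) s, DifferentiableAt ℂ L w ∧ e (L w) = w ∧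
      L w ∈ Metric.ball (t x : ℂ) r ∧ ∀ y, ι y = w → L w = t y := by
  obtain ⟨L, hL0, hLd, hLr, hLl⟩ := exists_holomorphic_local_inverse he (he' (t x))
  rw [← hιe] at hL0 hLd hLr
  have hLb : ∀ᶠ w in 𝓝 (ι x), L w ∈ Metric.ball (t x : ℂ) r := by
    have := hLd.self_of_nhds.continuousAt
    refine this.eventually ?_
    rw [hL0]; exact Metric.ball_mem_nhds _ hr
  have hLt : ∀ᶠ w in 𝓝 (ι x), ∀ y, ι y = w → L w = t y := by
    have hc : Tendsto (fun y => (t y : ℂ)) (𝓝 x) (𝓝 (t x : ℂ)) :=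
      (Complex.continuous_ofReal.comp ht).tendsto x
    have := hc.eventually hLl
    rw [hι.isInducing.nhds_eq_comap, eventually_comap] at this
    filter_upwards [this] with w hw y hy
    rw [← hw y hy, ← hιe, hy]
  obtain ⟨s, hs, h⟩ := Metric.eventually_nhds_iff_ball.1 (hLd.and (hLr.and (hLb.and hLt)))
  exact ⟨L, s, hs, h⟩

theorem exists_ball_chart (ht : IsOpenEmbedding t) (hιe : ∀ x, ι x = e (t x))
    (he : Differentiable ℂ e) (x : X) {r : ℝ} (hr : 0 < r) :
    ∃ s > 0, (∀ z ∈ Metric.ball (t x : ℂ) s, e z ∈ Metric.ball (ι x) r) ∧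
      ∀ y : ℝ, (y : ℂ) ∈ Metric.ball (t x : ℂ) s → y ∈ range t := by
  have h1 : ∀ᶠ z in 𝓝 (t x : ℂ), e z ∈ Metric.ball (ι x) r := by
    refine he.continuous.continuousAt.eventually ?_
    rw [← hιe]; exact Metric.ball_mem_nhds _ hr
  obtain ⟨s₁, hs₁, h1⟩ := Metric.eventually_nhds_iff_ball.1 h1
  obtain ⟨s₂, hs₂, h2⟩ := Metric.isOpen_iff.1 ht.isOpen_range _ (mem_range_self x)
  refine ⟨min s₁ s₂, lt_min hs₁ hs₂,
    fun z hz => h1 z (Metric.ball_subset_ball (min_le_left _ _) hz), fun y hy => h2 ?_⟩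
  rw [Metric.mem_ball, Real.dist_eq]
  exact (ofReal_mem_ball.1 hy).trans_le (min_le_right _ _)

/-- Composition with `e` or its local inverse transports the holomorphic part. The converse also has
to produce continuity along the entire curve, which is where continuity of `u` enters. -/
theorem extendsFromSideAt_iff_flatExt (ht : IsOpenEmbedding t) (hι : IsEmbedding ι)
    (hιe : ∀ x, ι x = e (t x)) (he : Differentiable ℂ e) (he' : ∀ z, deriv e z ≠ 0)
    (hS : ∀ z, e z ∈ S ↔ z ∈ O) (hu : Continuous u) (x : X) :
    ExtendsFromSideAt ι S u (ι x) ↔ ∃ r > 0, FlatExt O (inCoord t u) (t x) r := by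
  constructor
  · rintro ⟨r, hr, F, hFc, hFd, hF⟩
    obtain ⟨s, hs, hes, hst⟩ := exists_ball_chart ht hιe he x hr
    refine ⟨s, hs, fun z => F (e z), ?_, ?_, fun y hy => ?_⟩
    · refine hFc.comp he.continuous.continuousOn fun z hz => ?_
      rcases hz.2 with h | h
      · exact Or.inr ⟨hes z hz.1, (hS z).2 h⟩
      · have hre : z = (z.re : ℂ) := Complex.ext rfl (by simpa using h)
        obtain ⟨y, hy⟩ := hst z.re (hre ▸ hz.1)
        left
        rw [hre, ← hy, ← hιe]
        exact mem_range_self y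
    · exact hFd.comp he.differentiableOn fun z hz => ⟨hes z hz.1, (hS z).2 hz.2⟩
    · have hey := hes y hy
      obtain ⟨y, rfl⟩ := hst y hy
      rw [inCoord_apply ht.injective]
      simp only [← hιe] at hey ⊢
      exact hF y hey
  · rintro ⟨r, hr, G, hGc, hGd, hG⟩
    obtain ⟨L, s, hs, hL⟩ := exists_ball_local_inverse ht.continuous hι hιe he he' x hr
    classical
    have hLc : ContinuousOn L (Metric.ball (ι x) s) := fun w hw =>
      (hL w hw).1.continuousAt.continuousWithinAt
    have hLO : ∀ w ∈ Metric.ball (ι x) s ∩ S, L w ∈ Metric.ball (t x : ℂ) r ∩ O := fun w hw =>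
      ⟨(hL w hw.1).2.2.1, (hS _).1 ((hL w hw.1).2.1.symm ▸ hw.2)⟩
    have hHc : ContinuousOn (fun w => G (L w)) (Metric.ball (ι x) s ∩ (range ι ∪ S)) := by
      refine hGc.comp (hLc.mono inter_subset_left) fun w hw => ⟨(hL w hw.1).2.2.1, ?_⟩
      rcases hw.2 with ⟨y, hy⟩ | h
      · right
        rw [(hL w hw.1).2.2.2 y hy]
        exact Complex.ofReal_im _
      · exact Or.inl (hLO w ⟨hw.1, h⟩).2
    have hHu : ∀ y, ι y ∈ Metric.ball (ι x) s → G (L (ι y)) = u y := by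
      intro y hy
      have hy' := (hL _ hy).2.2
      have hLy := hy'.2 y rfl
      rw [hLy] at hy'
      simp only [hLy]
      rw [hG _ hy'.1, inCoord_apply ht.injective]
    -- Halving the radius leaves room for gluing: inside the larger ball `F` agrees with `G ∘ L` on
    -- the relevant set, while near any point outside it `F` is just `u` carried along the curve.
    set B := Metric.ball (ι x) (s / 2) with hB
    have hBs : B ⊆ Metric.ball (ι x) s := Metric.ball_subset_ball (by linarith)
    set F : ℂ → ℂ := fun w => if w ∈ B ∩ S then G (L w) else Function.extend ι u 0 w with hF
    have hFH : ∀ w ∈ range ι ∪ B ∩ S, w ∈ Metric.ball (ι x) s → F w = G (L w) := by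
      intro w hw hws
      by_cases h : w ∈ B ∩ S
      · exact if_pos h
      · obtain ⟨y, rfl⟩ := hw.resolve_right h
        simp only [hF, if_neg h, hι.injective.extend_apply, hHu y hws]
    refine ⟨s / 2, half_pos hs, F, fun p hp => ?_, ?_, fun y hy => ?_⟩
    · by_cases hps : p ∈ Metric.ball (ι x) s
      · have hnear : ∀ᶠ w in 𝓝[range ι ∪ B ∩ S] p, w ∈ Metric.ball (ι x) s :=
          mem_nhdsWithin_of_mem_nhds (Metric.isOpen_ball.mem_nhds hps)
        have hsub : range ι ∪ B ∩ S ⊆ range ι ∪ S := union_subset_union_right _ inter_subset_right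
        have hc : ContinuousWithinAt (fun w => G (L w)) (range ι ∪ B ∩ S) p :=
          (hHc p ⟨hps, hsub hp⟩).mono_of_mem_nhdsWithin
            (inter_mem hnear (mem_of_superset self_mem_nhdsWithin hsub))
        refine hc.congr_of_eventuallyEq ?_ (hFH p hp hps)
        filter_upwards [hnear, self_mem_nhdsWithin] with w hw hw' using hFH w hw' hw
      · have hpB : p ∉ B ∩ S := fun h => hps (hBs h.1)
        have hnear : ∀ᶠ w in 𝓝[range ι ∪ B ∩ S] p, w ∉ B := by
          have hpc : p ∉ Metric.closedBall (ι x) (s / 2) := fun h =>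
            hps (Metric.closedBall_subset_ball (by linarith) h)
          filter_upwards [mem_nhdsWithin_of_mem_nhds
            (Metric.isClosed_closedBall.isOpen_compl.mem_nhds hpc)] with w hw h
          exact hw (Metric.ball_subset_closedBall h)
        have hc : ContinuousWithinAt (Function.extend ι u 0) (range ι ∪ B ∩ S) p := by
          refine (continuousOn_extend_range hι hu p
            (hp.resolve_right hpB)).mono_of_mem_nhdsWithin ?_
          filter_upwards [hnear, self_mem_nhdsWithin] with w hw hw'
          exact hw'.resolve_right fun h => hw h.1
        refine hc.congr_of_eventuallyEq ?_ (if_neg hpB)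
        filter_upwards [hnear] with w hw using if_neg fun h => hw h.1
    · have hd : DifferentiableOn ℂ (fun w => G (L w)) (B ∩ S) :=
        hGd.comp (fun w hw => (hL w (hBs hw.1)).1.differentiableWithinAt)
          fun w hw => hLO w ⟨hBs hw.1, hw.2⟩
      exact hd.congr fun w hw => if_pos hw
    · rw [hFH _ (Or.inl (mem_range_self y)) (hBs hy), hHu y (hBs hy)]

theorem extendsToDiscAt_iff_flatExt (ht : IsOpenEmbedding t) (hι : IsEmbedding ι)
    (hιe : ∀ x, ι x = e (t x)) (he : Differentiable ℂ e) (he' : ∀ z, deriv e z ≠ 0) (x : X) :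
    ExtendsToDiscAt ι u (ι x) ↔ ∃ r > 0, FlatExt univ (inCoord t u) (t x) r := by
  constructor
  · rintro ⟨r, hr, F, hFd, hF⟩
    obtain ⟨s, hs, hes, hst⟩ := exists_ball_chart ht hιe he x hr
    have hd : DifferentiableOn ℂ (fun z => F (e z)) (Metric.ball (t x : ℂ) s) :=
      hFd.comp he.differentiableOn hes
    refine ⟨s, hs, fun z => F (e z), hd.continuousOn.mono inter_subset_left,
      hd.mono inter_subset_left, fun y hy => ?_⟩
    have hey := hes y hy
    obtain ⟨y, rfl⟩ := hst y hy
    rw [inCoord_apply ht.injective]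
    simp only [← hιe] at hey ⊢
    exact hF y hey
  · rintro ⟨r, hr, G, -, hGd, hG⟩
    obtain ⟨L, s, hs, hL⟩ := exists_ball_local_inverse ht.continuous hι hιe he he' x hr
    refine ⟨s, hs, fun w => G (L w), ?_, fun y hy => ?_⟩
    · exact hGd.comp (fun w hw => (hL w hw).1.differentiableWithinAt)
        fun w hw => ⟨(hL w hw).2.2.1, mem_univ _⟩
    · have hy' := (hL _ hy).2.2
      have hLy := hy'.2 y rfl
      rw [hLy] at hy'
      simp only [hLy]
      rw [hG _ hy'.1, inCoord_apply ht.injective]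

theorem DenseGdeltaInSpaces.congr {k : ℕ∞} {U V : Set (X → ℂ)} (hU : DenseGdeltaInSpaces t k U)
    (h : ∀ u : Ck t k, u.toFun ∈ U ↔ u.toFun ∈ V) : DenseGdeltaInSpaces t k V := by
  have h1 : {u : Ck t k | u.toFun ∈ V} = {u | u.toFun ∈ U} := by ext u; exact (h u).symm
  have h2 : {u : Ckb t k | u.toFun ∈ V} = {u | u.toFun ∈ U} := by
    ext u; exact (h u.toCk).symm
  have h3 : {u : Ck0 t k | u.toFun ∈ V} = {u | u.toFun ∈ U} := by
    ext u; exact (h u.toCk).symm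
  rw [DenseGdeltaInSpaces, h1, h2, h3]
  exact hU

/-- Genericity of non-extendability on a curve that is the image of an open subset of the real
line under an entire function without critical points. -/
theorem denseGdeltaInSpaces_of_chart {S' O' : Set ℂ} (ht : IsOpenEmbedding t)
    (hι : IsEmbedding ι) (hιe : ∀ x, ι x = e (t x)) (he : Differentiable ℂ e)
    (he' : ∀ z, deriv e z ≠ 0) (hO : O ∈ flatRegions) (hO' : O' ∈ flatRegions)
    (hS : ∀ z, e z ∈ S ↔ z ∈ O) (hS' : ∀ z, e z ∈ S' ↔ z ∈ O') (k : ℕ∞) :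
    DenseGdeltaInSpaces t k (NonextSide ι S) ∧ DenseGdeltaInSpaces t k (NonextSide ι S') ∧
      DenseGdeltaInSpaces t k (NonextBothSides ι S S') ∧
      DenseGdeltaInSpaces t k (NonextDisc ι) := by
  have side : ∀ {S O : Set ℂ}, (∀ z, e z ∈ S ↔ z ∈ O) → ∀ u : Ck t k,
      (¬ ∃ x₀ : X, ExtendsFromSideAt ι S u.toFun (ι x₀)) ↔
        ∀ x : X, ∀ r > 0, ¬ FlatExt O (inCoord t u.toFun) (t x) r := by
    intro S O hS u
    simp only [extendsFromSideAt_iff_flatExt ht hι hιe he he' hS (u.continuous_toFun ht)]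
    push Not
    rfl
  refine ⟨?_, ?_, ?_, ?_⟩
  · refine (denseGdeltaInSpaces_flatNonext ht k (singleton_subset_iff.2 hO)).congr fun u => ?_
    simp only [FlatNonext, NonextSide, mem_ofPred_eq, side hS u, mem_singleton_iff, forall_eq]
  · refine (denseGdeltaInSpaces_flatNonext ht k (singleton_subset_iff.2 hO')).congr fun u => ?_
    simp only [FlatNonext, NonextSide, mem_ofPred_eq, side hS' u, mem_singleton_iff, forall_eq]
  · refine (denseGdeltaInSpaces_flatNonext ht k (pair_subset hO hO')).congr fun u => ?_
    simp only [FlatNonext, NonextBothSides, mem_ofPred_eq, side hS u, side hS' u, mem_insert_iff,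
      mem_singleton_iff, forall_eq_or_imp, forall_eq]
  · refine (denseGdeltaInSpaces_flatNonext ht k (𝒪 := {univ})
      (singleton_subset_iff.2 (Or.inr (Or.inr rfl)))).congr fun u => ?_
    simp only [FlatNonext, NonextDisc, mem_ofPred_eq, extendsToDiscAt_iff_flatExt ht hι hιe he he',
      mem_singleton_iff, forall_eq]
    push Not
    rfl

end Transfer

/-! ### Arcs of the unit circle -/

section Arc

theorem differentiable_cexp_mul_I : Differentiable ℂ fun z : ℂ => Complex.exp (z * Complex.I) := by
  fun_prop

theorem deriv_cexp_mul_I_ne_zero (z : ℂ) :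
    deriv (fun z : ℂ => Complex.exp (z * Complex.I)) z ≠ 0 := by
  have : HasDerivAt (fun z : ℂ => Complex.exp (z * Complex.I))
      (Complex.exp (z * Complex.I) * (1 * Complex.I)) z :=
    ((hasDerivAt_id z).mul_const Complex.I).cexp
  rw [this.deriv]
  simp [Complex.exp_ne_zero]

theorem norm_cexp_mul_I (z : ℂ) : ‖Complex.exp (z * Complex.I)‖ = Real.exp (-z.im) := by
  rw [Complex.norm_exp]; simp

theorem injOn_circlePoint {a b : ℝ} (hab : b ≤ a + 2 * Real.pi) :
    InjOn circlePoint (Ioo a b) := by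
  intro x hx y hy h
  obtain ⟨n, hn⟩ := Complex.exp_eq_exp_iff_exists_int.1 h
  have hn' : (x : ℂ) = ((y + n * (2 * Real.pi) : ℝ) : ℂ) := by
    apply mul_right_cancel₀ Complex.I_ne_zero
    rw [hn]; push_cast; ring
  have hxy : x = y + n * (2 * Real.pi) := by exact_mod_cast hn'
  have hpi := Real.pi_pos
  have h1 : (n : ℝ) < 1 := by
    by_contra hcon
    push Not at hcon
    nlinarith [hx.2, hy.1]
  have h2 : (-1 : ℝ) < n := by
    by_contra hcon
    push Not at hcon
    nlinarith [hx.1, hy.2]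
  have h0 : n = 0 := by
    have : n < 1 := by exact_mod_cast h1
    have : -1 < n := by exact_mod_cast h2
    omega
  simpa [h0] using hxy

theorem range_arcAngle {a b : ℝ} (hab : b ≤ a + 2 * Real.pi) :
    range (arcAngle a b) = Ioo a b := by
  refine Subset.antisymm (range_subset_iff.2 (arcAngle_mem a b)) fun θ hθ => ?_
  refine ⟨⟨circlePoint θ, mem_image_of_mem _ hθ⟩, ?_⟩
  exact injOn_circlePoint hab (arcAngle_mem _ _ _) hθ (circlePoint_arcAngle a b _)

/-- Near a point of the arc, the angle is the real part of a holomorphic local inverse `L` of z ↦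
exp(iz): modulus 1 forces Im L = 0, and injectivity on the parameter interval identifies the value.
-/
theorem continuous_arcAngle {a b : ℝ} (hab : b ≤ a + 2 * Real.pi) :
    Continuous (arcAngle a b) := by
  rw [continuous_iff_continuousAt]
  intro x
  obtain ⟨L, hL0, hLd, hLr, -⟩ := exists_holomorphic_local_inverse differentiable_cexp_mul_I
    (deriv_cexp_mul_I_ne_zero (arcAngle a b x))
  have hx : Complex.exp ((arcAngle a b x : ℂ) * Complex.I) = x := circlePoint_arcAngle a b x
  rw [hx] at hL0 hLd hLr
  have hc : ContinuousAt (fun z : ℂ => (L z).re) x :=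
    Complex.continuous_re.continuousAt.comp hLd.self_of_nhds.continuousAt
  have hc' : ContinuousAt (fun y : openArc a b => (L y).re) x :=
    hc.comp (x := x) continuous_subtype_val.continuousAt
  have hIoo : ∀ᶠ y : openArc a b in 𝓝 x, (L y).re ∈ Ioo a b := by
    refine hc'.eventually (Ioo_mem_nhds ?_ ?_) <;> simp only [hL0, Complex.ofReal_re]
    · exact (arcAngle_mem a b x).1
    · exact (arcAngle_mem a b x).2
  refine hc'.congr ?_
  filter_upwards [hIoo, continuous_subtype_val.continuousAt.eventually hLr] with y hy hy'
  have hnorm : ‖(y : ℂ)‖ = 1 := by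
    rw [← circlePoint_arcAngle a b y]; exact Complex.norm_exp_ofReal_mul_I _
  have him : (L y).im = 0 := by
    rw [← hy', norm_cexp_mul_I, Real.exp_eq_one_iff] at hnorm
    linarith
  refine injOn_circlePoint hab hy (arcAngle_mem a b y) ?_
  rw [circlePoint_arcAngle, circlePoint]
  have : ((L y).re : ℂ) = L y := Complex.ext rfl (by simp [him])
  rw [this, hy']

theorem isOpenEmbedding_arcAngle {a b : ℝ} (hab : b ≤ a + 2 * Real.pi) :
    IsOpenEmbedding (arcAngle a b) := by
  refine ⟨⟨?_, ?_⟩, ?_⟩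
  · refine IsInducing.of_comp (g := circlePoint) (continuous_arcAngle hab)
      (by unfold circlePoint; fun_prop) ?_
    have : circlePoint ∘ arcAngle a b = Subtype.val := funext (circlePoint_arcAngle a b)
    rw [this]
    exact IsInducing.subtypeVal
  · intro x y h
    rw [Subtype.ext_iff, ← circlePoint_arcAngle a b x, h, circlePoint_arcAngle]
  · rw [range_arcAngle hab]; exact isOpen_Ioo

end Arc

end OneSidedExtension

/-! ### The three kinds of curve -/

theorem theorem4p20 (k : ℕ∞) :
    -- the real line
    (DenseGdeltaInSpaces (id : ℝ → ℝ) k (NonextSide lineIncl upperSide) ∧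
     DenseGdeltaInSpaces (id : ℝ → ℝ) k (NonextSide lineIncl lowerSide) ∧
     DenseGdeltaInSpaces (id : ℝ → ℝ) k (NonextBothSides lineIncl upperSide lowerSide) ∧
     DenseGdeltaInSpaces (id : ℝ → ℝ) k (NonextDisc lineIncl)) ∧
    -- bounded open intervals
    (∀ γ δ : ℝ, γ < δ →
      DenseGdeltaInSpaces (Subtype.val : Set.Ioo γ δ → ℝ) k
        (NonextSide (intervalIncl γ δ) upperSide) ∧
      DenseGdeltaInSpaces (Subtype.val : Set.Ioo γ δ → ℝ) k
        (NonextSide (intervalIncl γ δ) lowerSide) ∧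
      DenseGdeltaInSpaces (Subtype.val : Set.Ioo γ δ → ℝ) k
        (NonextBothSides (intervalIncl γ δ) upperSide lowerSide) ∧
      DenseGdeltaInSpaces (Subtype.val : Set.Ioo γ δ → ℝ) k
        (NonextDisc (intervalIncl γ δ))) ∧
    -- open arcs of the unit circle
    (∀ a b : ℝ, a < b → b ≤ a + 2 * Real.pi →
      DenseGdeltaInSpaces (arcAngle a b) k (NonextSide (arcIncl a b) outerSide) ∧
      DenseGdeltaInSpaces (arcAngle a b) k (NonextSide (arcIncl a b) innerSide) ∧
      DenseGdeltaInSpaces (arcAngle a b) k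
        (NonextBothSides (arcIncl a b) outerSide innerSide) ∧
      DenseGdeltaInSpaces (arcAngle a b) k (NonextDisc (arcIncl a b))) := by
  have up : upperSide ∈ flatRegions := Or.inl rfl
  have low : lowerSide ∈ flatRegions := Or.inr (Or.inl rfl)
  refine ⟨?_, fun γ δ _ => ?_, fun a b _ hab => ?_⟩
  · exact denseGdeltaInSpaces_of_chart (e := id) IsOpenEmbedding.id
      Complex.isometry_ofReal.isEmbedding (fun _ => rfl) differentiable_id (fun z => by simp)
      up low (fun _ => Iff.rfl) (fun _ => Iff.rfl) k
  · exact denseGdeltaInSpaces_of_chart (e := id) isOpen_Ioo.isOpenEmbedding_subtypeVal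
      (Complex.isometry_ofReal.isEmbedding.comp IsEmbedding.subtypeVal) (fun _ => rfl)
      differentiable_id (fun z => by simp) up low (fun _ => Iff.rfl) (fun _ => Iff.rfl) k
  -- Since |exp(iz)| = exp(-Im z), the exterior of the disc corresponds to the lower half-plane,
  -- hence the order `low up`.
  · exact denseGdeltaInSpaces_of_chart (isOpenEmbedding_arcAngle hab) IsEmbedding.subtypeVal
      (fun x => (circlePoint_arcAngle a b x).symm) differentiable_cexp_mul_I
      deriv_cexp_mul_I_ne_zero low up
      (fun z => by
        simp only [outerSide, lowerSide, mem_ofPred_eq, norm_cexp_mul_I, Real.one_lt_exp_iff]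
        exact neg_pos)
      (fun z => by
        simp only [innerSide, upperSide, mem_ofPred_eq, norm_cexp_mul_I, Real.exp_lt_one_iff]
        exact neg_lt_zero) k
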